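/- **Corollary 3.6 (Extension across a singular curve).** Let $\Omega\subset\mathbb R^2$ be a domain, $u\in C^2(\Omega)$, and let $$S(u)=\{(x,y)\in\Omega:\ u_x-y=0,\ u_y+x=0\}$$ be its singular set. On $\Omega\setminus S(u)$ put $D=\sqrt{(u_x-y)^2+(u_y+x)^2}$, $N(u)=\frac1D(u_x-y,\;u_y+x)$ and $N^\perp(u)=\frac1D(u_y+x,\;-(u_x-y))$. For an open set $U\subset\Omega\setminus S(u)$, a *characteristic curve in $U$* is the trace of a maximal integral curve of $N^\perp(u)$ in $U$. Let $\Gamma_s\subset S(u)$ be a $C^1$ curve (without end points), let $p_0\in\Gamma_s$, and suppose that a ball $B_\epsilon(p_0)\subset\Omega$ is divided by $\Gamma_s$ into two nonsingular parts: $B_\epsilon(p_0)\setminus\Gamma_s=B^+\cup B^-$, where $B^+$ and $B^-$ are disjoint domains containing no point of $S(u)$, each having $p_0$ in its closure. A characteristic curve $\Gamma$ in $B^+$ or in $B^-$ is said to *touch* $\Gamma_s$ at $p_0$ if $p_0\in\overline{\Gamma}$, and to touch it *transversally* if moreover $p_0$ is the only common point of the tangent line of $\Gamma_s$ at $p_0$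 and the tangent line of $\overline\Gamma$ at $p_0$. Then the limits $N^\perp(u)(p_0^{\pm})=\lim_{p\in B^\pm,\;p\to p_0}N^\perp(u)(p)$ exist, and: 1. There is a unique characteristic curve $\Gamma_+$ in $B^+$ touching $\Gamma_s$ at $p_0$. It touches $\Gamma_s$ transversally, and $N^\perp(u)(p_0^+)$ is a tangent vector of $\overline{\Gamma}_+$ at $p_0$. 2. There is a unique characteristic curve $\Gamma_-$ in $B^-$ touching $\Gamma_s$ at $p_0$. It touches $\Gamma_s$ transversally, and $N^\perp(u)(p_0^-)$ is a tangent vector of $\overline{\Gamma}_-$ at $p_0$. 3. $\Gamma_-\cup\{p_0\}\cup\Gamma_+$ is a $C^1$ curve in $B_\epsilon(p_0)$: it is the image of an open interval under an injective $C^1$ map with nowhere vanishing derivative, and near $p_0$ it consists of a single arc through $p_0$. -/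

import Mathlib

open Set Filter Topology

noncomputable section

/-- The Euclidean `xy`-plane; `p 0` and `p 1` are the coordinates `x` and `y` of `p`. -/
abbrev Plane : Type := EuclideanSpace ℝ (Fin 2)

namespace Heis

/-- The partial derivative `u_x`. -/
def dx (u : Plane → ℝ) (p : Plane) : ℝ := fderiv ℝ u p (EuclideanSpace.single 0 1)

/-- The partial derivative `u_y`. -/
def dy (u : Plane → ℝ) (p : Plane) : ℝ := fderiv ℝ u p (EuclideanSpace.single 1 1)

/-- The singular set `S(u)`: the points of the domain `Ω` of `u` where `u_x - y = 0` and
`u_y + x = 0`. -/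
def singularSet (u : Plane → ℝ) (Ω : Set Plane) : Set Plane :=
  {p ∈ Ω | dx u p - p 1 = 0 ∧ dy u p + p 0 = 0}

/-- `D = ((u_x - y)² + (u_y + x)²)^{1/2}`. -/
def D (u : Plane → ℝ) (p : Plane) : ℝ :=
  Real.sqrt ((dx u p - p 1) ^ 2 + (dy u p + p 0) ^ 2)

/-- `N(u) = (u_x - y, u_y + x) / D`, meaningful at nonsingular points. -/
def N (u : Plane → ℝ) (p : Plane) : Plane :=
  !₂[(dx u p - p 1) / D u p, (dy u p + p 0) / D u p]

/-- `N^⊥(u) = (u_y + x, -(u_x - y)) / D`, meaningful at nonsingular points. -/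
def Nperp (u : Plane → ℝ) (p : Plane) : Plane :=
  !₂[N u p 1, -(N u p 0)]

/-- `γ`, restricted to the open interval `J`, is an integral curve of `N^⊥(u)` in `U`. -/
structure IsCharParam (u : Plane → ℝ) (U : Set Plane) (γ : ℝ → Plane) (J : Set ℝ) : Prop where
  isOpen : IsOpen J
  ordConnected : J.OrdConnected
  nonempty : J.Nonempty
  mapsTo : MapsTo γ J U
  integral : IsIntegralCurveOn γ (fun _ => Nperp u) J

/-- A characteristic curve in an open set `U` of nonsingular points: the trace of a maximal
integral curve of `N^⊥(u)` in `U`, that is, a leaf in `U` of the characteristic foliation. -/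
def IsCharacteristicCurve (u : Plane → ℝ) (U Γ : Set Plane) : Prop :=
  ∃ (γ : ℝ → Plane) (J : Set ℝ), IsCharParam u U γ J ∧
    (∀ (γ' : ℝ → Plane) (J' : Set ℝ), IsCharParam u U γ' J' → J ⊆ J' → EqOn γ γ' J → J' = J) ∧
    Γ = γ '' J

/-- `γ` is a regular `C¹` parametrization over the nonempty open interval `J`. -/
structure IsRegularC1Param (γ : ℝ → Plane) (J : Set ℝ) : Prop where
  isOpen : IsOpen J
  ordConnected : J.OrdConnected
  nonempty : J.Nonempty
  contDiffOn : ContDiffOn ℝ 1 γ J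
  deriv_ne_zero : ∀ t ∈ J, deriv γ t ≠ 0

/-- A `C¹` smooth (immersed) curve in the plane; closed curves are included. -/
def IsC1Curve (Γ : Set Plane) : Prop :=
  ∃ (γ : ℝ → Plane) (J : Set ℝ), IsRegularC1Param γ J ∧ Γ = γ '' J

/-- `Γ` is a `C¹` smooth curve without self-intersections which passes through `p`, and near `p`
it consists of a single arc (it does not accumulate at `p` in any other way). -/
def IsSimpleC1CurveThrough (Γ : Set Plane) (p : Plane) : Prop :=
  ∃ (γ : ℝ → Plane) (J : Set ℝ), IsRegularC1Param γ J ∧ InjOn γ J ∧ Γ = γ '' J ∧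
    ∃ t ∈ J, γ t = p ∧ ∀ I ∈ 𝓝 t, γ '' (I ∩ J) ∈ 𝓝[Γ] p

/-- The tangent line at `p` of a curve `Γ` containing `p`, which may end at `p`: the translate
to `p` of the set of limits of `c (q - p)`, for real `c` and for `q` in `Γ` tending to `p`. -/
def tangentLine (Γ : Set Plane) (p : Plane) : Set Plane :=
  (fun v => p + v) '' tangentConeAt ℝ Γ p

/-- `Γ` touches at `p` (the curve on which `p` lies). -/
def Touches (Γ : Set Plane) (p : Plane) : Prop := p ∈ closure Γ

/-- `Γ` touches `Γs` at `p` transversally: it touches there, and the tangent lines at `p` of `Γs`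
and of (the closure of) `Γ` meet only at `p`. -/
def TouchesTransversally (Γ Γs : Set Plane) (p : Plane) : Prop :=
  Touches Γ p ∧ tangentLine Γs p ∩ tangentLine (closure Γ) p = {p}

end Heis

end

/-! Write `N^⊥ = V / ‖V‖` with `V = (u_y + x, -(u_x - y))`. The mixed derivatives of `u` cancel in
the trace of `DV`, which therefore equals `2`. At `p₀` the derivative also kills the tangent `T` of
the singular curve, because `V` vanishes along it. So `DV(p₀) = ν ⊗ v` has rank one, with `‖v‖ = 1`,
`ν v = 2` and `ν T = 0` (`exists_eq_smulRight`). Near `p₀` the field `V` is then almost a multiple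
of `v`, positive on one side of the curve and negative on the other. Hence `N^⊥` tends to `v` on one
side and to `-v` on the other, both transversal to the curve (`exists_two_sides`). Since `ν ⊗ v =
(-ν) ⊗ (-v)`, both sides satisfy the same condition `IsExpandingSide`: the flow leaves the curve.

On such a side the equation `γ' = N^⊥(γ)` is singular at `p₀`. Still, at time `t`, in a thin cone
about the ray in direction `v`, the field is Lipschitz with constant `1 / (2t)` (`exists_cone`),
because the rank-one part of `V` changes its length and hardly its direction. A constant `k / t`
with `k < 1` is just good enough: the integral equation for the velocity is a contraction
(`exists_start`), and two solutions from `p₀` differ by `O(t)`, hence by nothing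
(`eq_zero_of_norm_deriv_le`).

For uniqueness among all curves touching `p₀`, `ν` grows at a definite rate along trajectories near
`p₀`. Followed backwards from a nearby point, a trajectory must therefore end within a time
comparable to the distance to `p₀` (`exists_exit_time`). A touching curve thus starts at `p₀`, and
the local uniqueness applies. The two curves, one of them reversed, meet at `p₀` with the common
velocity `v`. -/

noncomputable section

/-! ### Trajectories of a normalized vector field issuing from a first-order zero -/

section Normed

variable {E : Type*} [NormedAddCommGroup E] [NormedSpace ℝ E]

/-- The normalization `V / ‖V‖` of a vector field. -/
def unitField (V : E → E) (p : E) : E := ‖V p‖⁻¹ • V p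

theorem norm_unitField_le (V : E → E) (p : E) : ‖unitField V p‖ ≤ 1 := by
  rw [unitField, norm_smul, norm_inv, norm_norm]
  exact inv_mul_le_one

theorem norm_normalize_sub_le (a b : E) (ha : a ≠ 0) :
    ‖‖b‖⁻¹ • b - ‖a‖⁻¹ • a‖ ≤ 2 * ‖b - a‖ / ‖a‖ := by
  have ha' : 0 < ‖a‖ := norm_pos_iff.2 ha
  have h1 : ‖b‖ • ‖b‖⁻¹ • b = b := by
    by_cases hb : b = 0
    · simp [hb]
    · rw [smul_smul, mul_inv_cancel₀ (norm_ne_zero_iff.2 hb), one_smul]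
  have h2 : ‖a‖ • ‖a‖⁻¹ • a = a := by
    rw [smul_smul, mul_inv_cancel₀ ha'.ne', one_smul]
  have h3 : ‖a‖ • (‖b‖⁻¹ • b - ‖a‖⁻¹ • a) = (‖a‖ - ‖b‖) • ‖b‖⁻¹ • b + (b - a) := by
    rw [smul_sub, sub_smul, h1, h2]; abel
  have h4 : ‖‖b‖⁻¹ • b‖ ≤ 1 := by
    rw [norm_smul, norm_inv, norm_norm]; exact inv_mul_le_one
  rw [le_div_iff₀ ha']
  calc ‖‖b‖⁻¹ • b - ‖a‖⁻¹ • a‖ * ‖a‖ = ‖‖a‖ • (‖b‖⁻¹ • b - ‖a‖⁻¹ • a)‖ := by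
        rw [norm_smul, norm_norm, mul_comm]
    _ ≤ ‖(‖a‖ - ‖b‖) • ‖b‖⁻¹ • b‖ + ‖b - a‖ := by rw [h3]; exact norm_add_le _ _
    _ ≤ ‖b - a‖ * 1 + ‖b - a‖ := by
        gcongr
        rw [norm_smul]
        refine mul_le_mul ?_ h4 (norm_nonneg _) (norm_nonneg _)
        rw [Real.norm_eq_abs, norm_sub_rev b a]
        exact abs_norm_sub_norm_le a b
    _ = 2 * ‖b - a‖ := by ring

/-- `B` is, near the zero `p₀` of the vector field `V`, the side of the hypersurface of zeros of `V`
into which `V` points; `V` vanishes to first order there, with derivative `ν ⊗ v`. -/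
structure IsExpandingSide (V : E → E) (B : Set E) (p₀ v : E) (ν : E →L[ℝ] ℝ) : Prop where
  strict : HasStrictFDerivAt V (ν.smulRight v) p₀
  zero : V p₀ = 0
  norm_eq : ‖v‖ = 1
  apply_eq : ν v = 2
  mem_iff : ∀ᶠ p in 𝓝 p₀, (p ∈ B ↔ 0 < ν (V p))
  tendsto : Tendsto (unitField V) (𝓝[B] p₀) (𝓝 v)

namespace IsExpandingSide

variable {V : E → E} {B : Set E} {p₀ v : E} {ν : E →L[ℝ] ℝ}

theorem notMem (h : IsExpandingSide V B p₀ v ν) : p₀ ∉ B := fun hp => by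
  have := h.mem_iff.self_of_nhds.1 hp
  simp [h.zero] at this

/-- Strict differentiability compares two arbitrary points near `p₀`, with an error relative to
their mutual distance; differentiability at `p₀` alone would not yield Lipschitz bounds. -/
theorem exists_norm_sub_le (h : HasStrictFDerivAt V (ν.smulRight v) p₀) {κ : ℝ} (hκ : 0 < κ) :
    ∃ r > 0, ∀ p ∈ Metric.ball p₀ r, ∀ q ∈ Metric.ball p₀ r,
      ‖V p - V q - ν (p - q) • v‖ ≤ κ * ‖p - q‖ := by
  have h1 := h.isLittleO.def hκ
  rw [nhds_prod_eq] at h1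
  obtain ⟨s, hs, hs'⟩ := mem_prod_same_iff.1 h1
  obtain ⟨r, hr, hrs⟩ := Metric.mem_nhds_iff.1 hs
  exact ⟨r, hr, fun p hp q hq => hs' (mk_mem_prod (hrs hp) (hrs hq))⟩

/-- Over the cone `‖V‖` is at least `t`, so a Lipschitz bound of order `1 / t` is automatic; the
point is a numerator below `1`. It comes from comparing `V q` with a positive multiple of `V p`,
which has the same direction: the main part `ν (q - p) • v` of the difference is absorbed, and only
an error with a small factor `κ` remains. -/
theorem exists_cone (h : IsExpandingSide V B p₀ v ν) :
    ∃ η > 0, ∃ r > 0, ∀ t, 0 < t → t < r → ∀ p ∈ Metric.closedBall (p₀ + t • v) (η * t),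
      p ∈ B ∧ ∀ q ∈ Metric.closedBall (p₀ + t • v) (η * t),
        ‖unitField V p - unitField V q‖ ≤ 1 / (2 * t) * ‖p - q‖ := by
  set L : ℝ := ‖ν‖ with hL
  have hL2 : 2 ≤ L := by
    have := ν.le_opNorm v
    rw [h.apply_eq, h.norm_eq, mul_one] at this
    simpa using this
  have hνle : ∀ x, |ν x| ≤ L * ‖x‖ := fun x => ν.le_opNorm x
  set κ : ℝ := 1 / (16 * (1 + 2 * L)) with hκdef
  have hκ : 0 < κ := by positivity
  have hκL : κ * (1 + 2 * L) = 1 / 16 := by rw [hκdef]; field_simp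
  obtain ⟨r₁, hr₁, hV⟩ := exists_norm_sub_le h.strict hκ
  obtain ⟨r₂, hr₂, hB⟩ := Metric.eventually_nhds_iff.1 h.mem_iff
  -- With this aperture `ν (p - p₀)` differs from `ν (t • v) = 2 * t` by at most `t / 4`.
  have hη : 0 < 1 / (4 * L) := by positivity
  refine ⟨1 / (4 * L), hη, min r₁ r₂ / 2, by positivity, fun t ht htr => ?_⟩
  have hLη : L * (1 / (4 * L)) = 1 / 4 := by field_simp
  set η := 1 / (4 * L) with hηd
  have hη1 : η ≤ 1 := by
    nlinarith
  have hp₀ : p₀ ∈ Metric.ball p₀ r₁ := Metric.mem_ball_self hr₁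
  have key : ∀ p ∈ Metric.closedBall (p₀ + t • v) (η * t),
      dist p p₀ < min r₁ r₂ ∧ 7 / 4 * t ≤ ν (p - p₀) ∧
        ‖V p - ν (p - p₀) • v‖ ≤ 2 * κ * t ∧ t ≤ ‖V p‖ ∧ 0 < ν (V p) := by
    intro p hp
    rw [Metric.mem_closedBall, dist_eq_norm] at hp
    have e1 : p - p₀ = t • v + (p - (p₀ + t • v)) := by abel
    have n1 : ‖p - p₀‖ ≤ 2 * t := by
      rw [e1]
      refine (norm_add_le _ _).trans ?_
      rw [norm_smul, h.norm_eq, Real.norm_of_nonneg ht.le]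
      nlinarith
    have d1 : dist p p₀ < min r₁ r₂ := by rw [dist_eq_norm]; linarith
    have hμ : 7 / 4 * t ≤ ν (p - p₀) := by
      have := hνle (p - (p₀ + t • v))
      have h3 : |ν (p - (p₀ + t • v))| ≤ 1 / 4 * t :=
        this.trans (by
          calc L * ‖p - (p₀ + t • v)‖ ≤ L * (η * t) := by gcongr
            _ = 1 / 4 * t := by rw [← mul_assoc, hLη])
      rw [e1, map_add, map_smul, h.apply_eq, smul_eq_mul]
      have := (abs_le.1 h3).1
      linarith
    have he : ‖V p - ν (p - p₀) • v‖ ≤ 2 * κ * t := by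
      have := hV p (d1.trans_le (min_le_left _ _)) p₀ hp₀
      rw [h.zero, sub_zero] at this
      nlinarith
    have hκ1 : 2 * κ ≤ 1 / 8 := by nlinarith
    refine ⟨d1, hμ, he, ?_, ?_⟩
    · have h1 : ‖ν (p - p₀) • v‖ ≤ ‖V p‖ + ‖V p - ν (p - p₀) • v‖ := by
        rw [← norm_neg (V p - ν (p - p₀) • v)]
        refine le_trans (le_of_eq ?_) (norm_add_le _ _)
        congr 1; abel
      rw [norm_smul, h.norm_eq, mul_one] at h1
      have h2 := (le_abs_self (ν (p - p₀))).trans h1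
      nlinarith
    · have h1 : ν (V p) = 2 * ν (p - p₀) + ν (V p - ν (p - p₀) • v) := by
        rw [map_sub ν (V p), map_smul, h.apply_eq, smul_eq_mul]; ring
      have h2 := (abs_le.1 (hνle (V p - ν (p - p₀) • v))).1
      have h3 : L * ‖V p - ν (p - p₀) • v‖ ≤ L * (2 * κ * t) := by gcongr
      nlinarith
  intro p hp
  obtain ⟨dp, hμ, he, hVp, hνp⟩ := key p hp
  refine ⟨(hB (dp.trans_le (min_le_right _ _))).2 hνp, fun q hq => ?_⟩
  obtain ⟨dq, hμq, heq, hVq, hνq⟩ := key q hq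
  have hpq : ‖q - p‖ ≤ 2 * (η * t) := by
    rw [Metric.mem_closedBall, dist_eq_norm] at hp hq
    calc ‖q - p‖ = ‖(q - (p₀ + t • v)) - (p - (p₀ + t • v))‖ := by congr 1; abel
      _ ≤ _ := (norm_sub_le _ _).trans (by linarith)
  set μ := ν (p - p₀)
  have hμ0 : 0 < μ := by nlinarith
  set c := ν (q - p) with hc
  have hcle : |c| ≤ L * ‖q - p‖ := hνle _
  have hc2 : |c| ≤ 1 / 2 * t := hcle.trans (by
    calc L * ‖q - p‖ ≤ L * (2 * (η * t)) := by gcongr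
      _ = 2 * (L * η) * t := by ring
      _ = 1 / 2 * t := by rw [hLη]; ring)
  have hcμ : |c / μ| ≤ 1 / 2 := by
    rw [abs_div, abs_of_pos hμ0, div_le_iff₀ hμ0]; nlinarith
  have hcμ' : |c / μ| ≤ L * ‖q - p‖ / t := by
    rw [abs_div, abs_of_pos hμ0, div_le_div_iff₀ hμ0 ht]
    have : 0 ≤ L * ‖q - p‖ := by positivity
    nlinarith
  -- As `V p ≈ μ • v`, this multiple of `V p` is close to `V p + c • v ≈ V q`.
  set a := (1 + c / μ) • V p with ha
  have hpos : 1 / 2 ≤ 1 + c / μ := by linarith [(abs_le.1 hcμ).1]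
  have hanorm : t / 2 ≤ ‖a‖ := by
    rw [ha, norm_smul, Real.norm_of_nonneg (by linarith)]; nlinarith
  have ha0 : a ≠ 0 := norm_pos_iff.1 (by linarith)
  have hXa : ‖a‖⁻¹ • a = unitField V p := by
    rw [ha, norm_smul, Real.norm_of_nonneg (by linarith), unitField, smul_smul]
    congr 1
    have hk : (1 + c / μ) ≠ 0 := by linarith
    rw [mul_inv, mul_right_comm, inv_mul_cancel₀ hk, one_mul]
  have hba : ‖V q - a‖ ≤ κ * (1 + 2 * L) * ‖q - p‖ := by
    have e : V q - a = (V q - V p - c • v) - (c / μ) • (V p - μ • v) := by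
      rw [ha, add_smul, one_smul, smul_sub, smul_smul, div_mul_cancel₀ _ hμ0.ne']; abel
    rw [e]
    calc _ ≤ ‖V q - V p - c • v‖ + ‖(c / μ) • (V p - μ • v)‖ := norm_sub_le _ _
      _ ≤ κ * ‖q - p‖ + L * ‖q - p‖ / t * (2 * κ * t) := by
          rw [norm_smul]
          gcongr
          · exact hV q (dq.trans_le (min_le_left _ _)) p (dp.trans_le (min_le_left _ _))
          · exact hcμ'
      _ = _ := by field_simp
  have hfin := norm_normalize_sub_le a (V q) ha0
  rw [hXa] at hfin
  rw [norm_sub_rev, norm_sub_rev p q]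
  refine hfin.trans ?_
  rw [hκL] at hba
  calc 2 * ‖V q - a‖ / ‖a‖ ≤ 2 * (1 / 16 * ‖q - p‖) / (t / 2) := by gcongr
    _ ≤ 1 / (2 * t) * ‖q - p‖ := by
        have : 2 * (1 / 16 * ‖q - p‖) / (t / 2) = 1 / (4 * t) * ‖q - p‖ := by field_simp; ring
        rw [this]
        gcongr
        norm_num

/-- Backwards in time a trajectory reaches the boundary after a time comparable to its distance
to `p₀`. -/
theorem exists_exit_time (h : IsExpandingSide V B p₀ v ν) :
    ∃ C > 0, ∃ d > 0, ∀ (γ : ℝ → E) (J : Set ℝ), J.OrdConnected →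
      (∀ t ∈ J, γ t ∈ B ∧ HasDerivWithinAt γ (unitField V (γ t)) J t) →
      ∀ s ∈ J, dist (γ s) p₀ < d → ∀ t ∈ J, s - C * dist (γ s) p₀ ≤ t := by
  set L : ℝ := ‖ν‖ with hL
  have hL0 : 0 ≤ L := norm_nonneg _
  have hνle : ∀ x, |ν x| ≤ L * ‖x‖ := fun x => ν.le_opNorm x
  have hκ : 0 < 1 / (2 * (L + 1)) := by positivity
  have hκL : L * (1 / (2 * (L + 1))) ≤ 1 / 2 := by
    rw [mul_one_div, div_le_div_iff₀ (by positivity) (by positivity)]; linarith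
  set κ := 1 / (2 * (L + 1))
  -- On `B` the derivative of `ν` along the flow is close to `ν v = 2`. The boundary of `B` is only
  -- tangent to `ker ν`, so `ν (p - p₀)` may be slightly negative there.
  have hev : ∀ᶠ p in 𝓝 p₀, p ∈ B → 1 ≤ ν (unitField V p) ∧ -(1 / 4) * ‖p - p₀‖ ≤ ν (p - p₀) := by
    have h1 : ∀ᶠ p in 𝓝[B] p₀, 1 < ν (unitField V p) := by
      have := (ν.continuous.tendsto v).comp h.tendsto
      rw [h.apply_eq] at this
      exact this.eventually (lt_mem_nhds (by norm_num))
    have h2 := h.strict.hasFDerivAt.isLittleO.def hκ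
    filter_upwards [eventually_nhdsWithin_iff.1 h1, h2, h.mem_iff] with p hp1 hp2 hp3 hpB
    refine ⟨(hp1 hpB).le, ?_⟩
    rw [h.zero, sub_zero] at hp2
    have h3 := hp3.1 hpB
    have h4 : ν (V p) = 2 * ν (p - p₀) + ν (V p - ν (p - p₀) • v) := by
      rw [map_sub ν (V p), map_smul, h.apply_eq, smul_eq_mul]; ring
    have h5 := (le_abs_self _).trans (hνle (V p - ν (p - p₀) • v))
    have h6 : L * ‖V p - ν (p - p₀) • v‖ ≤ L * (κ * ‖p - p₀‖) := by
      gcongr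
      exact hp2
    have h7 : L * (κ * ‖p - p₀‖) ≤ 1 / 2 * ‖p - p₀‖ := by
      rw [← mul_assoc]; gcongr
    linarith
  obtain ⟨r, hr, hball⟩ := Metric.eventually_nhds_iff.1 hev
  set C := 2 * (L + 1) with hC
  have hC0 : 0 < C := by positivity
  refine ⟨C, hC0, r / (C + 1), by positivity, fun γ J hJ hγ s hs hd t ht => ?_⟩
  by_contra! hlt
  set d := dist (γ s) p₀ with hdd
  rw [lt_div_iff₀ (by positivity)] at hd
  have hd0 : 0 < d := dist_pos.2 fun h0 => h.notMem (h0 ▸ (hγ s hs).1)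
  set t₂ := s - C * d with ht₂
  have hsub : Icc t₂ s ⊆ J := (Icc_subset_Icc_left hlt.le).trans (hJ.out ht hs)
  have hle : t₂ ≤ s := by nlinarith
  have hder : ∀ τ ∈ Icc t₂ s, HasDerivWithinAt γ (unitField V (γ τ)) (Icc t₂ s) τ :=
    fun τ hτ => (hγ τ (hsub hτ)).2.mono hsub
  have hdist : ∀ τ ∈ Icc t₂ s, dist (γ τ) p₀ < r := by
    intro τ hτ
    have h1 := (convex_Icc t₂ s).norm_image_sub_le_of_norm_hasDerivWithin_le (C := 1) hder
      (fun x _ => norm_unitField_le V _) (right_mem_Icc.2 hle) hτ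
    have h2 : ‖τ - s‖ ≤ C * d := by
      rw [Real.norm_eq_abs, abs_sub_comm, abs_of_nonneg (by linarith [hτ.2])]
      linarith [hτ.1]
    have h3 := dist_triangle (γ τ) (γ s) p₀
    rw [← dist_eq_norm] at h1
    linarith
  have hν : ∀ τ ∈ Icc t₂ s, HasDerivWithinAt (fun x => ν (γ x)) (ν (unitField V (γ τ)))
      (Icc t₂ s) τ := fun τ hτ => ν.hasFDerivAt.comp_hasDerivWithinAt τ (hder τ hτ)
  have hmono : MonotoneOn (fun x => ν (γ x) - x) (Icc t₂ s) := by
    refine monotoneOn_of_hasDerivWithinAt_nonneg (f' := fun τ => ν (unitField V (γ τ)) - 1)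
      (convex_Icc _ _) ?_ ?_ ?_
    · exact fun τ hτ => ((hν τ hτ).sub (hasDerivWithinAt_id τ _)).continuousWithinAt
    · exact fun τ hτ => ((hν τ (interior_subset hτ)).sub (hasDerivWithinAt_id τ _)).mono
        interior_subset
    · exact fun τ hτ => sub_nonneg.2
        (hball (hdist τ (interior_subset hτ)) (hγ τ (hsub (interior_subset hτ))).1).1
  have h1 := hmono (left_mem_Icc.2 hle) (right_mem_Icc.2 hle) hle
  have h2 := (hball (hdist t₂ (left_mem_Icc.2 hle)) (hγ t₂ (hsub (left_mem_Icc.2 hle))).1).2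
  have h3 : ‖γ t₂ - p₀‖ ≤ (C + 1) * d := by
    have h1 := (convex_Icc t₂ s).norm_image_sub_le_of_norm_hasDerivWithin_le (C := 1) hder
      (fun x _ => norm_unitField_le V _) (right_mem_Icc.2 hle) (left_mem_Icc.2 hle)
    have h2 : ‖t₂ - s‖ ≤ C * d := by
      rw [Real.norm_eq_abs, abs_sub_comm, abs_of_nonneg (by linarith)]
      linarith
    have h3 := dist_triangle (γ t₂) (γ s) p₀
    rw [← dist_eq_norm] at h1 ⊢
    linarith
  have h4 := (le_abs_self _).trans (hνle (γ s - p₀))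
  rw [← dist_eq_norm, ← hdd] at h4
  simp only [map_sub] at h2 h4
  -- The growth of `ν` gives `ν (γ s - p₀) ≥ C * d - (C + 1) * d / 4`, whereas it is at most `L * d
  -- = (C / 2 - 1) * d`.
  nlinarith

/-- A Gronwall argument for a singular coefficient: a bound `M * t` makes the derivative at most `M
/ 2`, and integrating from `0` improves the bound to `M / 2 * t`; iterate. The factor `1 / 2` must
be below `1`, since `f t = t` satisfies the inequality with `1 / t`. -/
theorem eq_zero_of_norm_deriv_le {f f' : ℝ → E} {δ M : ℝ}
    (hf : ∀ t ∈ Ioo 0 δ, HasDerivAt f (f' t) t)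
    (hle : ∀ t ∈ Ioo 0 δ, ‖f' t‖ ≤ 1 / (2 * t) * ‖f t‖)
    (hM : ∀ t ∈ Ioo 0 δ, ‖f t‖ ≤ M * t) : ∀ t ∈ Ioo 0 δ, f t = 0 := by
  have step : ∀ M, (∀ t ∈ Ioo 0 δ, ‖f t‖ ≤ M * t) → ∀ t ∈ Ioo 0 δ, ‖f t‖ ≤ M / 2 * t := by
    intro M hM t ht
    have h1 : ∀ s ∈ Ioo 0 t, ‖f t‖ ≤ M * s + M / 2 * (t - s) := by
      intro s hs
      have hsub : Icc s t ⊆ Ioo 0 δ := fun x hx => ⟨hs.1.trans_le hx.1, hx.2.trans_lt ht.2⟩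
      have := (convex_Icc s t).norm_image_sub_le_of_norm_hasDerivWithin_le (C := M / 2)
        (fun x hx => (hf x (hsub hx)).hasDerivWithinAt)
        (fun x hx => (hle x (hsub hx)).trans (by
          have hx0 := (hsub hx).1
          calc 1 / (2 * x) * ‖f x‖ ≤ 1 / (2 * x) * (M * x) := by
                gcongr; exact hM x (hsub hx)
            _ = M / 2 := by field_simp))
        (left_mem_Icc.2 hs.2.le) (right_mem_Icc.2 hs.2.le)
      rw [Real.norm_of_nonneg (by linarith [hs.2])] at this
      have h2 := hM s (hsub (left_mem_Icc.2 hs.2.le))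
      have h3 := norm_sub_norm_le (f t) (f s)
      linarith
    have h2 : Tendsto (fun s => M * s + M / 2 * (t - s)) (𝓝[>] 0) (𝓝 (M * 0 + M / 2 * (t - 0))) :=
      (Continuous.tendsto (by fun_prop) 0).mono_left nhdsWithin_le_nhds
    have h3 := ge_of_tendsto h2 (eventually_of_mem (Ioo_mem_nhdsGT ht.1) h1)
    simpa using h3
  have hn : ∀ n : ℕ, ∀ t ∈ Ioo 0 δ, ‖f t‖ ≤ M / 2 ^ n * t := by
    intro n
    induction n with
    | zero => simpa using hM
    | succ k ih =>
      intro t ht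
      have := step _ ih t ht
      rwa [div_div, ← pow_succ] at this
  intro t ht
  have h1 : Tendsto (fun n : ℕ => M / 2 ^ n * t) atTop (𝓝 (0 * t)) := by
    refine Tendsto.mul_const t ?_
    have := (tendsto_pow_atTop_nhds_zero_of_lt_one (r := (1 / 2 : ℝ)) (by norm_num)
      (by norm_num)).const_mul M
    simpa [div_eq_mul_inv] using this
  rw [zero_mul] at h1
  exact norm_le_zero_iff.1 (ge_of_tendsto h1 (Eventually.of_forall fun n => hn n t ht))

/-- A trajectory starting at `p₀` starts with velocity `v`. -/
theorem hasDerivWithinAt_start (h : IsExpandingSide V B p₀ v ν) {γ : ℝ → E} {δ : ℝ} (hδ : 0 < δ)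
    (hB : ∀ t ∈ Ioo 0 δ, γ t ∈ B)
    (hder : ∀ t ∈ Ioo 0 δ, HasDerivAt γ (unitField V (γ t)) t)
    (hlim : Tendsto γ (𝓝[>] 0) (𝓝 p₀)) (h0 : γ 0 = p₀) :
    HasDerivWithinAt γ v (Ici 0) 0 := by
  have hmem : Ioo 0 δ ∈ 𝓝[>] (0 : ℝ) := Ioo_mem_nhdsGT hδ
  refine hasDerivWithinAt_Ici_of_tendsto_deriv (s := Ioo 0 δ)
    (fun t ht => (hder t ht).differentiableAt.differentiableWithinAt) ?_ hmem ?_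
  · rw [ContinuousWithinAt, h0]
    exact hlim.mono_left (nhdsWithin_mono _ Ioo_subset_Ioi_self)
  · have h1 : Tendsto γ (𝓝[>] 0) (𝓝[B] p₀) :=
      tendsto_nhdsWithin_iff.2 ⟨hlim, eventually_of_mem hmem hB⟩
    exact (h.tendsto.comp h1).congr' (eventually_of_mem hmem fun t ht => (hder t ht).deriv.symm)

/-- Brings any trajectory starting at `p₀` into the region where `exists_cone` applies. -/
theorem eventually_mem_cone (h : IsExpandingSide V B p₀ v ν) {γ : ℝ → E} {δ : ℝ} (hδ : 0 < δ)
    (hB : ∀ t ∈ Ioo 0 δ, γ t ∈ B)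
    (hder : ∀ t ∈ Ioo 0 δ, HasDerivAt γ (unitField V (γ t)) t)
    (hlim : Tendsto γ (𝓝[>] 0) (𝓝 p₀)) {η : ℝ} (hη : 0 < η) :
    ∀ᶠ t in 𝓝[>] (0 : ℝ), γ t ∈ Metric.closedBall (p₀ + t • v) (η * t) := by
  -- The value `γ 0` is arbitrary here, so it is replaced by the limit `p₀`.
  have heq : ∀ t ∈ Ioi (0 : ℝ), Function.update γ 0 p₀ t = γ t :=
    fun t ht => Function.update_of_ne (ne_of_gt ht) _ _
  have h1 := h.hasDerivWithinAt_start (γ := Function.update γ 0 p₀) hδ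
    (fun t ht => by rw [heq t ht.1]; exact hB t ht)
    (fun t ht => by
      rw [heq t ht.1]
      exact (hder t ht).congr_of_eventuallyEq
        (eventually_of_mem (Ioi_mem_nhds ht.1) heq))
    (hlim.congr' (eventually_of_mem self_mem_nhdsWithin fun t ht => (heq t ht).symm)) (by simp)
  have h2 := (hasDerivWithinAt_iff_isLittleO.1 h1).def hη
  have h3 := h2.filter_mono (nhdsWithin_mono _ Ioi_subset_Ici_self)
  filter_upwards [h3, self_mem_nhdsWithin] with t ht ht0
  have ht0' : (0 : ℝ) < t := ht0
  rw [heq t ht0, Function.update_self, sub_zero, Real.norm_of_nonneg ht0'.le] at ht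
  rw [Metric.mem_closedBall, dist_eq_norm, ← sub_sub]
  exact ht

theorem eventually_eq_of_start (h : IsExpandingSide V B p₀ v ν) {γ γ' : ℝ → E} {δ : ℝ} (hδ : 0 < δ)
    (hB : ∀ t ∈ Ioo 0 δ, γ t ∈ B)
    (hder : ∀ t ∈ Ioo 0 δ, HasDerivAt γ (unitField V (γ t)) t)
    (hlim : Tendsto γ (𝓝[>] 0) (𝓝 p₀))
    (hB' : ∀ t ∈ Ioo 0 δ, γ' t ∈ B)
    (hder' : ∀ t ∈ Ioo 0 δ, HasDerivAt γ' (unitField V (γ' t)) t)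
    (hlim' : Tendsto γ' (𝓝[>] 0) (𝓝 p₀)) :
    ∀ᶠ t in 𝓝[>] (0 : ℝ), γ t = γ' t := by
  obtain ⟨η, hη, r, hr, hcone⟩ := h.exists_cone
  have h1 := (h.eventually_mem_cone hδ hB hder hlim hη).and
    (h.eventually_mem_cone hδ hB' hder' hlim' hη)
  obtain ⟨r', hr', hsub⟩ := (mem_nhdsGT_iff_exists_Ioo_subset).1 h1
  have hr'0 : 0 < r' := hr'
  set ρ := min δ (min r r') with hρ
  have hρ0 : 0 < ρ := lt_min hδ (lt_min hr hr'0)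
  have hmem : ∀ t ∈ Ioo 0 ρ, t ∈ Ioo 0 δ ∧ t < r ∧ t ∈ Ioo 0 r' := fun t ht =>
    ⟨⟨ht.1, ht.2.trans_le (min_le_left _ _)⟩,
      ht.2.trans_le ((min_le_right _ _).trans (min_le_left _ _)),
      ⟨ht.1, ht.2.trans_le ((min_le_right _ _).trans (min_le_right _ _))⟩⟩
  refine eventually_of_mem (Ioo_mem_nhdsGT hρ0) fun t ht => sub_eq_zero.1 ?_
  refine eq_zero_of_norm_deriv_le (f := fun t => γ t - γ' t) (M := 2 * η)
    (fun t ht => (hder t (hmem t ht).1).sub (hder' t (hmem t ht).1)) ?_ ?_ t ht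
  · intro t ht
    have := hsub (hmem t ht).2.2
    exact (hcone t ht.1 (hmem t ht).2.1 _ this.1).2 _ this.2
  · intro t ht
    have := hsub (hmem t ht).2.2
    have h3 := dist_triangle_right (γ t) (γ' t) (p₀ + t • v)
    have h4 := Metric.mem_closedBall.1 this.1
    have h5 := Metric.mem_closedBall.1 this.2
    rw [← dist_eq_norm]
    linarith

theorem norm_intervalIntegral_sub_le {f g : ℝ → E} (hf : Continuous f) (hg : Continuous g)
    {c t : ℝ} (ht : 0 ≤ t) (hc : ∀ s, ‖f s - g s‖ ≤ c) :
    ‖(∫ s in (0 : ℝ)..t, f s) - ∫ s in (0 : ℝ)..t, g s‖ ≤ c * t := by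
  rw [← intervalIntegral.integral_sub (hf.intervalIntegrable _ _) (hg.intervalIntegrable _ _)]
  refine (intervalIntegral.norm_integral_le_of_norm_le_const fun s _ => hc s).trans ?_
  rw [sub_zero, abs_of_nonneg ht]

open BoundedContinuousFunction in
/-- There is a trajectory in `B` which starts at `p₀`. -/
theorem exists_start [CompleteSpace E] (h : IsExpandingSide V B p₀ v ν)
    (hX : ContinuousOn (unitField V) B) :
    ∃ (γ : ℝ → E) (r : ℝ), 0 < r ∧ Continuous γ ∧ γ 0 = p₀ ∧
      ∀ t ∈ Ioo 0 r, γ t ∈ B ∧ HasDerivAt γ (unitField V (γ t)) t := by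
  classical
  obtain ⟨η₀, hη₀, r₀, hr₀, hcone⟩ := h.exists_cone
  set η := min η₀ 1
  have hη : 0 < η := lt_min hη₀ one_pos
  obtain ⟨r₁, hr₁, hXv⟩ := Metric.eventually_nhds_iff.1 (eventually_nhdsWithin_iff.1
    (h.tendsto.eventually (Metric.closedBall_mem_nhds v hη)))
  set r := min r₀ r₁ / 4
  have hr : 0 < r := by positivity
  have hrr₀ : r < r₀ := by
    have := min_le_left r₀ r₁
    have : 0 < min r₀ r₁ := lt_min hr₀ hr₁
    simp only [r]; linarith
  have hrr₁ : 2 * r < r₁ := by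
    have := min_le_right r₀ r₁
    have : 0 < min r₀ r₁ := lt_min hr₀ hr₁
    simp only [r]; linarith
  -- `unitField V` has the default value `0` at `p₀`; `Y` is its continuous extension from `B`.
  set Y : E → E := Function.update (unitField V) p₀ v with hY
  have hYB : ∀ p ∈ B, Y p = unitField V p := fun p hp =>
    Function.update_of_ne (by rintro rfl; exact h.notMem hp) _ _
  have hYc : ContinuousOn Y (insert p₀ B) := by
    intro p hp
    rcases eq_or_ne p p₀ with rfl | hne
    · rw [hY, continuousWithinAt_update_same]
      refine h.tendsto.mono_left (nhdsWithin_mono _ ?_)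
      intro q hq
      exact hq.1.resolve_left hq.2
    · have hpB : p ∈ B := hp.resolve_left hne
      rw [hY, continuousWithinAt_update_of_ne hne, continuousWithinAt_insert]
      exact hX p hpB
  set S : Set (ℝ →ᵇ E) := Metric.closedBall 0 η
  have hSle : ∀ ζ ∈ S, ∀ t, ‖ζ t‖ ≤ η := fun ζ hζ t =>
    (ζ.norm_coe_le_norm t).trans (mem_closedBall_zero_iff.1 hζ)
  -- The unknown is the deviation `ζ` of the velocity from `v`. Deviations at sup distance `d` give
  -- paths at distance at most `d * t`, and the factor `t` cancels the singularity of the Lipschitz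
  -- constant `1 / (2 * t)`.
  let path (ζ : ℝ →ᵇ E) (t : ℝ) : E := p₀ + t • v + ∫ s in (0 : ℝ)..t, ζ s
  have hpathc : ∀ ζ, Continuous (path ζ) := fun ζ =>
    (continuous_const.add (continuous_id.smul continuous_const)).add
      (intervalIntegral.continuous_primitive (fun a b => ζ.continuous.intervalIntegrable a b) 0)
  have hpath0 : ∀ ζ, path ζ 0 = p₀ := fun ζ => by simp [path]
  have hpath : ∀ ζ ∈ S, ∀ t, 0 ≤ t → path ζ t ∈ Metric.closedBall (p₀ + t • v) (η * t) := by
    intro ζ hζ t ht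
    rw [Metric.mem_closedBall, dist_eq_norm]
    have := norm_intervalIntegral_sub_le ζ.continuous (continuous_const (y := (0 : E))) ht
      (c := η) (fun s => by simpa using hSle ζ hζ s)
    simpa [path] using this
  have hpathB : ∀ ζ ∈ S, ∀ t ∈ Ioc 0 r, path ζ t ∈ Metric.closedBall (p₀ + t • v) (η₀ * t) ∧
      path ζ t ∈ B ∧ ‖unitField V (path ζ t) - v‖ ≤ η := by
    intro ζ hζ t ht
    have h1 := hpath ζ hζ t ht.1.le
    have h2 : path ζ t ∈ Metric.closedBall (p₀ + t • v) (η₀ * t) :=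
      Metric.closedBall_subset_closedBall
        (mul_le_mul_of_nonneg_right (min_le_left _ _) ht.1.le) h1
    have h3 := (hcone t ht.1 (ht.2.trans_lt hrr₀) _ h2).1
    refine ⟨h2, h3, ?_⟩
    rw [← dist_eq_norm]
    refine Metric.mem_closedBall.1 (hXv ?_ h3)
    have h4 := Metric.mem_closedBall.1 h1
    have h5 : dist (p₀ + t • v) p₀ = t := by
      rw [dist_self_add_left, norm_smul, h.norm_eq, mul_one, Real.norm_of_nonneg ht.1.le]
    have h6 := dist_triangle (path ζ t) (p₀ + t • v) p₀
    have h7 : η ≤ 1 := min_le_right _ _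
    nlinarith [ht.1, ht.2]
  -- Freezing the time outside `[0, r]` makes the new deviation bounded and continuous on the whole
  -- line.
  let clamp : ℝ → ℝ := fun t => max 0 (min t r)
  have hclampc : Continuous clamp := by fun_prop
  have hclamp : ∀ t, clamp t = 0 ∨ clamp t ∈ Ioc 0 r := by
    intro t
    rcases (le_max_left 0 (min t r)).eq_or_lt with h0 | h0
    · exact Or.inl h0.symm
    · exact Or.inr ⟨h0, max_le hr.le (min_le_right _ _)⟩
  have hYle : ∀ ζ ∈ S, ∀ t, ‖Y (path ζ (clamp t)) - v‖ ≤ η := by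
    intro ζ hζ t
    rcases hclamp t with h0 | h0
    · rw [h0, hpath0, hY, Function.update_self, sub_self, norm_zero]; exact hη.le
    · obtain ⟨-, h2, h3⟩ := hpathB ζ hζ _ h0
      rwa [hYB _ h2]
  have hYcont : ∀ ζ ∈ S, Continuous fun t => Y (path ζ (clamp t)) - v := by
    intro ζ hζ
    refine (hYc.comp_continuous ((hpathc ζ).comp hclampc) fun t => ?_).sub continuous_const
    rcases hclamp t with h0 | h0
    · rw [Function.comp_apply, h0, hpath0]; exact mem_insert _ _
    · exact mem_insert_of_mem _ (hpathB ζ hζ _ h0).2.1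
  let T : S → S := fun ζ => ⟨ofNormedAddCommGroup _ (hYcont ζ.1 ζ.2) η (hYle ζ.1 ζ.2),
    mem_closedBall_zero_iff.2 (norm_ofNormedAddCommGroup_le _ hη.le _)⟩
  have hT : ContractingWith (1 / 2) T := by
    refine ⟨by rw [← NNReal.coe_lt_coe]; norm_num, LipschitzWith.of_dist_le_mul fun ζ ξ => ?_⟩
    rw [Subtype.dist_eq, BoundedContinuousFunction.dist_le (by positivity)]
    intro t
    have hd : ∀ s, ‖ζ.1 s - ξ.1 s‖ ≤ dist ζ ξ := fun s => by
      rw [← dist_eq_norm]; exact dist_coe_le_dist s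
    change dist (Y (path ζ.1 (clamp t)) - v) (Y (path ξ.1 (clamp t)) - v) ≤ _
    rw [dist_sub_right]
    rcases hclamp t with h0 | h0
    · rw [h0, hpath0, hpath0, dist_self]; positivity
    · obtain ⟨h1, h2, -⟩ := hpathB ζ.1 ζ.2 _ h0
      obtain ⟨h1', h2', -⟩ := hpathB ξ.1 ξ.2 _ h0
      rw [hYB _ h2, hYB _ h2', dist_eq_norm]
      refine ((hcone _ h0.1 (h0.2.trans_lt hrr₀) _ h1).2 _ h1').trans ?_
      have h3 := norm_intervalIntegral_sub_le ζ.1.continuous ξ.1.continuous h0.1.le hd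
      have h4 : path ζ.1 (clamp t) - path ξ.1 (clamp t) =
          (∫ s in (0 : ℝ)..clamp t, ζ.1 s) - ∫ s in (0 : ℝ)..clamp t, ξ.1 s := by
        simp only [path]; abel
      rw [h4]
      have h5 := h0.1
      calc 1 / (2 * clamp t) * _ ≤ 1 / (2 * clamp t) * (dist ζ ξ * clamp t) := by gcongr
        _ = _ := by
          rw [NNReal.coe_div, NNReal.coe_one, NNReal.coe_ofNat]
          field_simp
  have : CompleteSpace S := (Metric.isClosed_closedBall).completeSpace_coe
  obtain ⟨ζ, hζ, -⟩ := hT.exists_fixedPoint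
    (⟨0, Metric.mem_closedBall_self hη.le⟩ : S) (edist_ne_top _ _)
  refine ⟨path ζ.1, r, hr, hpathc _, hpath0 _, fun t ht => ?_⟩
  have htB := (hpathB ζ.1 ζ.2 t ⟨ht.1, ht.2.le⟩).2.1
  refine ⟨htB, ?_⟩
  have hfix : ζ.1 t = unitField V (path ζ.1 t) - v := by
    have h1 : (T ζ).1 t = ζ.1 t := by rw [hζ]
    rw [← h1]
    change Y (path ζ.1 (clamp t)) - v = _
    have : clamp t = t := by
      simp only [clamp]
      rw [min_eq_left ht.2.le, max_eq_right ht.1.le]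
    rw [this, hYB _ htB]
  have h1 : HasDerivAt (path ζ.1) (v + ζ.1 t) t := by
    refine HasDerivAt.add ?_ (intervalIntegral.integral_hasDerivAt_right
      (ζ.1.continuous.intervalIntegrable _ _)
      (ζ.1.continuous.stronglyMeasurableAtFilter _ _) ζ.1.continuous.continuousAt)
    simpa using ((hasDerivAt_id t).smul_const v).const_add p₀
  rwa [hfix, add_sub_cancel] at h1

end IsExpandingSide

end Normed

/-! ### Uniqueness and maximal integral curves away from the singular set -/

theorem eqOn_of_hasDerivAt_of_contDiffOn {E : Type*} [NormedAddCommGroup E] [NormedSpace ℝ E]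
    {X : E → E} {B : Set E} (hB : IsOpen B) (hX : ContDiffOn ℝ 1 X B) {γ γ' : ℝ → E} {J : Set ℝ}
    (hJ : IsOpen J) (hJc : IsPreconnected J)
    (hγ : ∀ t ∈ J, γ t ∈ B ∧ HasDerivAt γ (X (γ t)) t)
    (hγ' : ∀ t ∈ J, γ' t ∈ B ∧ HasDerivAt γ' (X (γ' t)) t)
    {t₀ : ℝ} (ht₀ : t₀ ∈ J) (h0 : γ t₀ = γ' t₀) : EqOn γ γ' J := by
  suffices hsub : J ⊆ {t | γ t = γ' t} ∩ J from fun t ht => (hsub ht).1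
  refine hJc.subset_of_closure_inter_subset ?_ ⟨t₀, ht₀, h0, ht₀⟩ ?_
  · rw [isOpen_iff_mem_nhds]
    intro t ht
    obtain ⟨K, s, hs, hlip⟩ :=
      (hX.contDiffAt (hB.mem_nhds (hγ t ht.2).1)).exists_lipschitzOnWith
    have hs' : s ∈ 𝓝 (γ' t) := by rw [← show γ t = γ' t from ht.1]; exact hs
    have hJt := hJ.mem_nhds ht.2
    have heq : γ =ᶠ[𝓝 t] γ' := by
      refine ODE_solution_unique_of_eventually (v := fun _ => X) (s := fun _ => s) (K := K)
        (Eventually.of_forall fun _ => hlip) ?_ ?_ ht.1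
      · filter_upwards [hJt, (hγ t ht.2).2.continuousAt hs] with x hx hxs
        exact ⟨(hγ x hx).2, hxs⟩
      · filter_upwards [hJt, (hγ' t ht.2).2.continuousAt hs'] with x hx hxs
        exact ⟨(hγ' x hx).2, hxs⟩
    exact (heq.and hJt).mono fun _ h => h
  · rintro t ⟨htc, htJ⟩
    refine ⟨?_, htJ⟩
    have hc : ContinuousAt (fun x => (γ x, γ' x)) t :=
      (hγ t htJ).2.continuousAt.prodMk (hγ' t htJ).2.continuousAt
    have h1 : (γ t, γ' t) ∈ closure (diagonal E) :=
      hc.continuousWithinAt.mem_closure htc fun x hx => hx.1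
    rwa [isClosed_diagonal.closure_eq] at h1

namespace Heis

variable {u : Plane → ℝ} {U : Set Plane} {γ γ' : ℝ → Plane} {J J' : Set ℝ}

theorem IsCharParam.hasDerivAt (h : IsCharParam u U γ J) {t : ℝ} (ht : t ∈ J) :
    HasDerivAt γ (Nperp u (γ t)) t :=
  (h.integral t ht).hasDerivAt (h.isOpen.mem_nhds ht)

theorem IsCharParam.of_hasDerivAt (hJ : IsOpen J) (hJc : J.OrdConnected) (hne : J.Nonempty)
    (h : ∀ t ∈ J, γ t ∈ U ∧ HasDerivAt γ (Nperp u (γ t)) t) : IsCharParam u U γ J :=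
  ⟨hJ, hJc, hne, fun t ht => (h t ht).1, fun t ht => (h t ht).2.hasDerivWithinAt⟩

theorem IsCharParam.eqOn (hU : IsOpen U) (hX : ContDiffOn ℝ 1 (Nperp u) U)
    (h : IsCharParam u U γ J) (h' : IsCharParam u U γ' J') {t₀ : ℝ} (ht₀ : t₀ ∈ J) (ht₀' : t₀ ∈ J')
    (h0 : γ t₀ = γ' t₀) : EqOn γ γ' (J ∩ J') :=
  eqOn_of_hasDerivAt_of_contDiffOn hU hX (h.isOpen.inter h'.isOpen)
    (h.ordConnected.inter h'.ordConnected).isPreconnected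
    (fun _ ht => ⟨h.mapsTo ht.1, h.hasDerivAt ht.1⟩)
    (fun _ ht => ⟨h'.mapsTo ht.2, h'.hasDerivAt ht.2⟩) ⟨ht₀, ht₀'⟩ h0

theorem IsCharParam.comp_add_const (h : IsCharParam u U γ J) (c : ℝ) :
    IsCharParam u U (fun t => γ (t + c)) ((· + c) ⁻¹' J) := by
  refine .of_hasDerivAt (h.isOpen.preimage (by fun_prop)) ?_ ?_ ?_
  · exact h.ordConnected.preimage_mono fun a b hab => by simpa using hab
  · obtain ⟨t, ht⟩ := h.nonempty
    exact ⟨t - c, by simpa using ht⟩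
  · exact fun t ht => ⟨h.mapsTo ht, (h.hasDerivAt ht).comp_add_const t c⟩

/-- A family of integral curves defined on intervals with a common point, and with a common value
there, has a common extension to the union of the intervals. -/
theorem IsCharParam.exists_iUnion (hU : IsOpen U) (hX : ContDiffOn ℝ 1 (Nperp u) U)
    {ι : Type*} [Nonempty ι] {γ : ι → ℝ → Plane} {J : ι → Set ℝ}
    (h : ∀ i, IsCharParam u U (γ i) (J i)) {t₀ : ℝ} {p : Plane}
    (ht₀ : ∀ i, t₀ ∈ J i) (hp : ∀ i, γ i t₀ = p) :
    ∃ σ, IsCharParam u U σ (⋃ i, J i) ∧ ∀ i, EqOn σ (γ i) (J i) := by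
  classical
  let σ : ℝ → Plane := fun t => if ht : ∃ i, t ∈ J i then γ ht.choose t else 0
  have hσ : ∀ i, EqOn σ (γ i) (J i) := by
    intro i t ht
    have hex : ∃ i, t ∈ J i := ⟨i, ht⟩
    simp only [σ, dif_pos hex]
    exact (h hex.choose).eqOn hU hX (h i) (ht₀ _) (ht₀ i) ((hp _).trans (hp i).symm)
      ⟨hex.choose_spec, ht⟩
  refine ⟨σ, .of_hasDerivAt (isOpen_iUnion fun i => (h i).isOpen) ?_ ?_ ?_, hσ⟩
  · exact (isPreconnected_iUnion ⟨t₀, mem_iInter.2 ht₀⟩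
      fun i => (h i).ordConnected.isPreconnected).ordConnected
  · exact ⟨t₀, mem_iUnion.2 ⟨Classical.arbitrary ι, ht₀ _⟩⟩
  · intro t ht
    obtain ⟨i, hi⟩ := mem_iUnion.1 ht
    rw [hσ i hi]
    exact ⟨(h i).mapsTo hi, ((h i).hasDerivAt hi).congr_of_eventuallyEq
      (eventually_of_mem ((h i).isOpen.mem_nhds hi) (hσ i))⟩

/-- The integral curve has no extension to a larger interval. -/
def IsMaximalCharParam (u : Plane → ℝ) (U : Set Plane) (γ : ℝ → Plane) (J : Set ℝ) : Prop :=
  IsCharParam u U γ J ∧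
    ∀ (γ' : ℝ → Plane) (J' : Set ℝ), IsCharParam u U γ' J' → J ⊆ J' → EqOn γ γ' J → J' = J

/-- By uniqueness all extensions agree where they overlap, so their union is itself an extension and
Zorn's lemma is not needed. -/
theorem IsCharParam.exists_maximal (hU : IsOpen U) (hX : ContDiffOn ℝ 1 (Nperp u) U)
    (h : IsCharParam u U γ J) :
    ∃ γ' J', IsMaximalCharParam u U γ' J' ∧ J ⊆ J' ∧ EqOn γ γ' J := by
  obtain ⟨t₀, ht₀⟩ := h.nonempty
  let ι := {q : (ℝ → Plane) × Set ℝ // IsCharParam u U q.1 q.2 ∧ J ⊆ q.2 ∧ EqOn γ q.1 J}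
  have : Nonempty ι := ⟨⟨(γ, J), h, Subset.rfl, fun _ _ => rfl⟩⟩
  obtain ⟨σ, hσ, hσe⟩ := IsCharParam.exists_iUnion hU hX (γ := fun i : ι => i.1.1)
    (J := fun i : ι => i.1.2) (fun i => i.2.1) (fun i => i.2.2.1 ht₀)
    (fun i => (i.2.2.2 ht₀).symm)
  have hJ : J ⊆ ⋃ i : ι, i.1.2 :=
    subset_iUnion (fun i : ι => i.1.2) ⟨(γ, J), h, Subset.rfl, fun _ _ => rfl⟩
  have heq : EqOn γ σ J := fun t ht =>
    (hσe ⟨(γ, J), h, Subset.rfl, fun _ _ => rfl⟩ ht).symm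
  refine ⟨σ, _, ⟨hσ, fun γ' J' h' hsub he => ?_⟩, hJ, heq⟩
  refine Subset.antisymm ?_ hsub
  exact subset_iUnion (fun i : ι => i.1.2)
    ⟨(γ', J'), h', hJ.trans hsub, fun t ht => (heq ht).trans (he (hJ ht))⟩

theorem IsMaximalCharParam.extends (hU : IsOpen U) (hX : ContDiffOn ℝ 1 (Nperp u) U)
    (h : IsMaximalCharParam u U γ J) (h' : IsCharParam u U γ' J') {t₀ : ℝ} (ht₀ : t₀ ∈ J)
    (ht₀' : t₀ ∈ J') (h0 : γ t₀ = γ' t₀) : J' ⊆ J ∧ EqOn γ γ' J' := by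
  obtain ⟨σ, hσ, hσe⟩ := IsCharParam.exists_iUnion hU hX
    (γ := fun b : Bool => if b then γ else γ') (J := fun b : Bool => if b then J else J')
    (t₀ := t₀) (p := γ t₀) (by simp [h.1, h']) (by simp [ht₀, ht₀']) (by simp [h0])
  have hJ : J ⊆ ⋃ b : Bool, if b then J else J' :=
    subset_iUnion (fun b : Bool => if b then J else J') true
  have hJ' : J' ⊆ J := by
    have := h.2 σ _ hσ hJ fun t ht => (hσe true ht).symm
    rw [← this]
    exact subset_iUnion (fun b : Bool => if b then J else J') false
  exact ⟨hJ', fun t ht => h.1.eqOn hU hX h' ht₀ ht₀' h0 ⟨hJ' ht, ht⟩⟩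

/-- Two characteristic curves with a common point coincide. -/
theorem IsMaximalCharParam.image_eq (hU : IsOpen U) (hX : ContDiffOn ℝ 1 (Nperp u) U)
    (h : IsMaximalCharParam u U γ J) (h' : IsMaximalCharParam u U γ' J') {t t' : ℝ} (ht : t ∈ J)
    (ht' : t' ∈ J') (h0 : γ t = γ' t') : γ '' J = γ' '' J' := by
  have key : ∀ {γ γ' J J'}, IsMaximalCharParam u U γ J → IsMaximalCharParam u U γ' J' →
      ∀ {t t'}, t ∈ J → t' ∈ J' → γ t = γ' t' → γ' '' J' ⊆ γ '' J := by
    intro γ γ' J J' h h' t t' ht ht' h0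
    have h1 := h.extends hU hX (h'.1.comp_add_const (t' - t)) ht (by simpa using ht')
      (by simpa using h0)
    rintro _ ⟨s, hs, rfl⟩
    have hs' : s - (t' - t) ∈ (· + (t' - t)) ⁻¹' J' := by simpa using hs
    exact ⟨_, h1.1 hs', by simpa using h1.2 hs'⟩
  exact (key h' h ht' ht h0.symm).antisymm (key h h' ht ht' h0)

end Heis

/-! ### The characteristic curve issuing from `p₀` on one side -/

namespace Heis

variable {u : Plane → ℝ} {B : Set Plane} {p₀ v : Plane} {γ : ℝ → Plane} {J : Set ℝ}
  {V : Plane → Plane} {ν : Plane →L[ℝ] ℝ}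

/-- `γ` is a maximal integral curve in `B` which starts at the boundary point `p₀` at time `0`. -/
structure IsStartParam (u : Plane → ℝ) (B : Set Plane) (p₀ : Plane) (γ : ℝ → Plane) (J : Set ℝ) :
    Prop where
  maximal : IsMaximalCharParam u B γ J
  subset : J ⊆ Ioi 0
  exists_Ioo : ∃ r > 0, Ioo 0 r ⊆ J
  tendsto : Tendsto γ (𝓝[>] 0) (𝓝 p₀)

theorem IsStartParam.mem_nhdsGT (hγ : IsStartParam u B p₀ γ J) : J ∈ 𝓝[>] (0 : ℝ) := by
  obtain ⟨r, hr, hrJ⟩ := hγ.exists_Ioo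
  exact mem_of_superset (Ioo_mem_nhdsGT hr) hrJ

theorem IsStartParam.Ioc_subset (hγ : IsStartParam u B p₀ γ J) {t : ℝ} (ht : t ∈ J) :
    Ioc 0 t ⊆ J := by
  intro s hs
  obtain ⟨r, hr, hrJ⟩ := hγ.exists_Ioo
  have h1 : min s (r / 2) ∈ J := hrJ ⟨lt_min hs.1 (by linarith),
    (min_le_right _ _).trans_lt (by linarith)⟩
  exact hγ.maximal.1.ordConnected.out h1 ht ⟨min_le_left _ _, hs.2⟩

/-- If `γ s = γ (s + c)` with `c > 0`, then `γ` agrees with its translate by `c` down to time `0`.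
The limit there gives `p₀ = γ c ∈ B`, which is impossible. -/
theorem IsStartParam.injOn (hγ : IsStartParam u B p₀ γ J) (hB : IsOpen B)
    (hX : ContDiffOn ℝ 1 (Nperp u) B) (hp₀ : p₀ ∉ B) : InjOn γ J := by
  have key : ∀ s ∈ J, ∀ t ∈ J, s < t → γ s ≠ γ t := by
    intro s hs t ht hst heq
    set c := t - s with hc
    have hc0 : 0 < c := sub_pos.2 hst
    have hs0 : 0 < s := hγ.subset hs
    have h1 := hγ.maximal.1.comp_add_const c
    have h2 := hγ.maximal.1.eqOn hB hX h1 hs (show s + c ∈ J by rwa [hc, add_sub_cancel])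
      (by rw [hc, add_sub_cancel]; exact heq)
    have hcJ : c ∈ J := hγ.Ioc_subset ht ⟨hc0, by linarith⟩
    have h3 : ∀ᶠ x in 𝓝[>] (0 : ℝ), γ x = γ (x + c) := by
      filter_upwards [Ioo_mem_nhdsGT hs0] with x hx
      exact h2 ⟨hγ.Ioc_subset hs ⟨hx.1, hx.2.le⟩,
        hγ.Ioc_subset ht ⟨add_pos hx.1 hc0, by linarith [hx.2]⟩⟩
    have h4 : Tendsto (fun x => γ (x + c)) (𝓝[>] 0) (𝓝 (γ c)) := by
      have h5 : ContinuousAt (fun x => γ (x + c)) 0 :=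
        ContinuousAt.comp (g := γ) (by simpa using (hγ.maximal.1.hasDerivAt hcJ).continuousAt)
          (by fun_prop)
      simpa using h5.tendsto.mono_left nhdsWithin_le_nhds
    have h5 := tendsto_nhds_unique (hγ.tendsto.congr' h3) h4
    exact hp₀ (h5 ▸ hγ.maximal.1.mapsTo hcJ)
  intro s hs t ht heq
  by_contra hne
  rcases lt_or_gt_of_ne hne with h | h
  · exact key s hs t ht h heq
  · exact key t ht s hs h heq.symm

/-- The exit time estimate for integral curves of `N^⊥(u)`. -/
theorem exists_exit_time (h : IsExpandingSide V B p₀ v ν) (hV : Nperp u = unitField V) :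
    ∃ C > 0, ∃ d > 0, ∀ (γ : ℝ → Plane) (J : Set ℝ), IsCharParam u B γ J →
      ∀ s ∈ J, dist (γ s) p₀ < d → ∀ t ∈ J, s - C * dist (γ s) p₀ ≤ t := by
  obtain ⟨C, hC, d, hd, hex⟩ := h.exists_exit_time
  refine ⟨C, hC, d, hd, fun γ J hγ => hex γ J hγ.ordConnected fun t ht => ?_⟩
  rw [← hV]
  exact ⟨hγ.mapsTo ht, hγ.integral t ht⟩

/-- Turns estimates in the time parameter into estimates in the distance to `p₀`; in particular the
curve comes back near `p₀` at no late time. -/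
theorem IsStartParam.exists_time_le (h : IsExpandingSide V B p₀ v ν) (hV : Nperp u = unitField V)
    (hγ : IsStartParam u B p₀ γ J) :
    ∃ C > 0, ∃ d > 0, ∀ t ∈ J, dist (γ t) p₀ < d → t ≤ C * dist (γ t) p₀ := by
  obtain ⟨C, hC, d, hd, hex⟩ := exists_exit_time h hV
  refine ⟨C, hC, d, hd, fun t ht htd => ?_⟩
  have h1 : t - C * dist (γ t) p₀ ≤ 0 :=
    ge_of_tendsto (tendsto_id'.2 nhdsWithin_le_nhds : Tendsto id (𝓝[>] (0 : ℝ)) (𝓝 0))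
      (mem_of_superset hγ.mem_nhdsGT fun s hs => hex γ J hγ.maximal.1 t ht htd s hs)
  linarith

theorem IsStartParam.mem_closure (hγ : IsStartParam u B p₀ γ J) : p₀ ∈ closure (γ '' J) :=
  mem_closure_of_tendsto hγ.tendsto
    (mem_of_superset hγ.mem_nhdsGT fun _ ht => mem_image_of_mem γ ht)

/-- The maximal extension of the local solution cannot continue to negative times: its points at
small positive times are close to `p₀`, and the exit estimate bounds the past from there. -/
theorem exists_isStartParam (h : IsExpandingSide V B p₀ v ν) (hV : Nperp u = unitField V)
    (hB : IsOpen B) (hX : ContDiffOn ℝ 1 (Nperp u) B) :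
    ∃ γ J, IsStartParam u B p₀ γ J := by
  obtain ⟨σ, r, hr, hσc, hσ0, hσ⟩ := h.exists_start (hV ▸ hX.continuousOn)
  rw [← hV] at hσ
  have hσp : IsCharParam u B σ (Ioo 0 r) :=
    .of_hasDerivAt isOpen_Ioo ordConnected_Ioo (nonempty_Ioo.2 hr) hσ
  obtain ⟨γ, J, hγ, hJ, heq⟩ := hσp.exists_maximal hB hX
  have hlim : Tendsto γ (𝓝[>] 0) (𝓝 p₀) := by
    have h1 : Tendsto σ (𝓝[>] 0) (𝓝 p₀) := by
      rw [← hσ0]; exact hσc.continuousAt.tendsto.mono_left nhdsWithin_le_nhds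
    exact h1.congr' (eventually_of_mem (Ioo_mem_nhdsGT hr) heq)
  obtain ⟨C, hC, d, hd, hex⟩ := exists_exit_time h hV
  have hnonneg : ∀ t ∈ J, 0 ≤ t := by
    intro t ht
    have h1 : Tendsto (fun s => s - C * dist (γ s) p₀) (𝓝[>] 0) (𝓝 (0 - C * dist p₀ p₀)) :=
      (tendsto_id'.2 nhdsWithin_le_nhds).sub ((hlim.dist tendsto_const_nhds).const_mul C)
    rw [dist_self, mul_zero, sub_zero] at h1
    refine le_of_tendsto h1 ?_
    filter_upwards [Ioo_mem_nhdsGT hr, hlim (Metric.ball_mem_nhds p₀ hd)] with s hs hsd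
    exact hex γ J hγ.1 s (hJ hs) hsd t ht
  refine ⟨γ, J, hγ, fun t ht => (hnonneg t ht).lt_of_ne ?_, ⟨r, hr, hJ⟩, hlim⟩
  rintro rfl
  obtain ⟨ε, hε, hεJ⟩ := Metric.isOpen_iff.1 hγ.1.isOpen 0 ht
  have := hnonneg (-(ε / 2)) (hεJ (by
    rw [Metric.mem_ball, dist_zero_right, norm_neg, Real.norm_of_nonneg (by linarith)]; linarith))
  linarith

/-- The curve has points arbitrarily near `p₀`, so the exit estimate bounds its interval below and
makes it converge to `p₀` at the left end. After translating that end to `0`, it agrees with `γ` at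
small times. -/
theorem IsStartParam.eq_of_touches (h : IsExpandingSide V B p₀ v ν) (hV : Nperp u = unitField V)
    (hB : IsOpen B) (hX : ContDiffOn ℝ 1 (Nperp u) B) (hγ : IsStartParam u B p₀ γ J)
    {Γ : Set Plane} (hΓ : IsCharacteristicCurve u B Γ) (ht : Touches Γ p₀) : Γ = γ '' J := by
  obtain ⟨σ, I, hσ, hmax, rfl⟩ := hΓ
  obtain ⟨C, hC, d, hd, hex⟩ := exists_exit_time h hV
  have hnear : ∀ ε > 0, ∃ s ∈ I, dist (σ s) p₀ < ε := by
    intro ε hε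
    obtain ⟨_, ⟨s, hs, rfl⟩, hd⟩ := Metric.mem_closure_iff.1 ht ε hε
    exact ⟨s, hs, by rwa [dist_comm]⟩
  have hbdd : BddBelow I := by
    obtain ⟨s, hs, hsd⟩ := hnear d hd
    exact ⟨_, fun t ht => hex σ I hσ s hs hsd t ht⟩
  set α := sInf I
  have hmem : ∀ s ∈ I, ∀ t ∈ Ioc α s, t ∈ I := by
    intro s hs t ht
    obtain ⟨x, hx, hxt⟩ := exists_lt_of_csInf_lt hσ.nonempty ht.1
    exact hσ.ordConnected.out hx hs ⟨hxt.le, ht.2⟩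
  have hlt : ∀ s ∈ I, α < s := by
    intro s hs
    obtain ⟨ε, hε, hεI⟩ := Metric.isOpen_iff.1 hσ.isOpen s hs
    have h1 : s - ε / 2 ∈ I := hεI (by
      rw [Metric.mem_ball, dist_self_sub_left, Real.norm_of_nonneg (by linarith)]; linarith)
    linarith [csInf_le hbdd h1]
  -- From a point at distance `ρ` of `p₀` the remaining backward time is at most `C * ρ`, so at unit
  -- speed the curve stays within `(1 + C) * ρ`.
  have hlim : Tendsto σ (𝓝[>] α) (𝓝 p₀) := by
    rw [Metric.tendsto_nhds]
    intro ε hε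
    obtain ⟨s, hs, hsd⟩ := hnear (min d (ε / (1 + C))) (by positivity)
    have h1 := hsd.trans_le (min_le_left _ _)
    have h2 := hsd.trans_le (min_le_right _ _)
    rw [lt_div_iff₀ (by positivity)] at h2
    filter_upwards [Ioo_mem_nhdsGT (hlt s hs)] with t ht
    have htI := hmem s hs t ⟨ht.1, ht.2.le⟩
    have h3 := hex σ I hσ s hs h1 t htI
    have hsub : Icc t s ⊆ I := hσ.ordConnected.out htI hs
    have h4 := (convex_Icc t s).norm_image_sub_le_of_norm_hasDerivWithin_le (C := 1)
      (fun x hx => (hσ.hasDerivAt (hsub hx)).hasDerivWithinAt)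
      (fun x _ => by rw [hV]; exact norm_unitField_le V _) (right_mem_Icc.2 ht.2.le)
      (left_mem_Icc.2 ht.2.le)
    rw [← dist_eq_norm, Real.norm_eq_abs, abs_sub_comm, abs_of_pos (sub_pos.2 ht.2)] at h4
    have h5 := dist_triangle (σ t) (σ s) p₀
    linarith
  have hτ := hσ.comp_add_const α
  have hτlim : Tendsto (fun t => σ (t + α)) (𝓝[>] 0) (𝓝 p₀) := by
    refine hlim.comp (tendsto_nhdsWithin_iff.2 ⟨?_, ?_⟩)
    · have : Tendsto (fun t : ℝ => t + α) (𝓝 0) (𝓝 (0 + α)) := by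
        exact Continuous.tendsto (by fun_prop) 0
      rw [zero_add] at this
      exact this.mono_left nhdsWithin_le_nhds
    · filter_upwards [self_mem_nhdsWithin] with t ht
      have : (0 : ℝ) < t := ht
      simp only [mem_Ioi]; linarith
  obtain ⟨s, hs⟩ := hσ.nonempty
  obtain ⟨r, hr, hrJ⟩ := hγ.exists_Ioo
  set δ := min r (s - α)
  have hδ : 0 < δ := lt_min hr (sub_pos.2 (hlt s hs))
  have hδJ : Ioo 0 δ ⊆ J := fun t ht => hrJ ⟨ht.1, ht.2.trans_le (min_le_left _ _)⟩
  have hδI : ∀ t ∈ Ioo 0 δ, t + α ∈ I := fun t ht => hmem s hs _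
    ⟨by linarith [ht.1], by linarith [ht.2.trans_le (min_le_right r (s - α))]⟩
  have hev := h.eventually_eq_of_start (γ := γ) (γ' := fun t => σ (t + α)) hδ
    (fun t ht => hγ.maximal.1.mapsTo (hδJ ht))
    (fun t ht => by rw [← hV]; exact hγ.maximal.1.hasDerivAt (hδJ ht)) hγ.tendsto
    (fun t ht => hσ.mapsTo (hδI t ht))
    (fun t ht => by rw [← hV]; exact hτ.hasDerivAt (hδI t ht)) hτlim
  obtain ⟨t, ht, htδ⟩ := (hev.and (Ioo_mem_nhdsGT hδ)).exists
  exact (hγ.maximal.image_eq hB hX ⟨hσ, hmax⟩ (hδJ htδ) (hδI t htδ) ht).symm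

theorem IsStartParam.isLittleO (h : IsExpandingSide V B p₀ v ν) (hV : Nperp u = unitField V)
    (hγ : IsStartParam u B p₀ γ J) {η : ℝ} (hη : 0 < η) :
    ∀ᶠ t in 𝓝[>] (0 : ℝ), ‖γ t - p₀ - t • v‖ ≤ η * t := by
  obtain ⟨r, hr, hrJ⟩ := hγ.exists_Ioo
  filter_upwards [h.eventually_mem_cone hr (fun t ht => hγ.maximal.1.mapsTo (hrJ ht))
    (fun t ht => by rw [← hV]; exact hγ.maximal.1.hasDerivAt (hrJ ht)) hγ.tendsto hη] with t ht
  rwa [Metric.mem_closedBall, dist_eq_norm, ← sub_sub] at ht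

theorem IsStartParam.tendsto_slope (h : IsExpandingSide V B p₀ v ν) (hV : Nperp u = unitField V)
    (hγ : IsStartParam u B p₀ γ J) :
    Tendsto (fun t => t⁻¹ • (γ t - p₀)) (𝓝[>] 0) (𝓝 v) := by
  rw [Metric.tendsto_nhds]
  intro ε hε
  filter_upwards [hγ.isLittleO h hV (half_pos hε), self_mem_nhdsWithin] with t ht ht0
  have ht0 : (0 : ℝ) < t := ht0
  have h1 : t⁻¹ • (γ t - p₀) - v = t⁻¹ • (γ t - p₀ - t • v) := by
    rw [smul_sub _ _ (t • v), smul_smul, inv_mul_cancel₀ ht0.ne', one_smul]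
  rw [dist_eq_norm, h1, norm_smul, norm_inv, Real.norm_of_nonneg ht0.le]
  calc t⁻¹ * ‖γ t - p₀ - t • v‖ ≤ t⁻¹ * (ε / 2 * t) := by gcongr
    _ = ε / 2 := by field_simp
    _ < ε := by linarith

theorem IsStartParam.tangentConeAt_eq (h : IsExpandingSide V B p₀ v ν)
    (hV : Nperp u = unitField V) (hγ : IsStartParam u B p₀ γ J) :
    tangentConeAt ℝ (closure (γ '' J)) p₀ = (Submodule.span ℝ {v} : Set Plane) := by
  rw [tangentConeAt_closure]
  apply Subset.antisymm
  · intro y hy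
    -- `P` is the projection along `v` onto `ker ν`. On the curve `P (q - p₀)` is `o(‖q - p₀‖)`, so
    -- within it this map has both derivatives `P` and `0`, which must agree on the tangent cone.
    let P : Plane →L[ℝ] Plane := ContinuousLinearMap.id ℝ Plane - ((1 / 2 : ℝ) • ν).smulRight v
    have hP : ∀ x, P x = x - (1 / 2 * ν x) • v := fun x => by simp [P]
    have hPv : P v = 0 := by rw [hP, h.apply_eq]; simp
    have h1 : HasFDerivWithinAt (fun q => P (q - p₀)) P (γ '' J) p₀ :=
      (P.hasFDerivAt.comp p₀ ((hasFDerivAt_id p₀).sub_const p₀)).hasFDerivWithinAt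
    have h2 : HasFDerivWithinAt (fun q => P (q - p₀)) (0 : Plane →L[ℝ] Plane) (γ '' J) p₀ := by
      rw [hasFDerivWithinAt_iff_isLittleO, Asymptotics.isLittleO_iff]
      intro c hc
      obtain ⟨C, hC, d, hd, hle⟩ := hγ.exists_time_le h hV
      obtain ⟨δ, hδ, hδs⟩ := mem_nhdsGT_iff_exists_Ioo_subset.1
        (hγ.isLittleO h hV (show 0 < c / ((‖P‖ + 1) * C) by positivity))
      have hδ0 : (0 : ℝ) < δ := hδ
      rw [eventually_nhdsWithin_iff]
      filter_upwards [Metric.ball_mem_nhds p₀ (show 0 < min d (δ / C) by positivity)]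
      rintro _ hq ⟨t, ht, rfl⟩
      have hq1 := (Metric.mem_ball.1 hq).trans_le (min_le_left _ _)
      have hq2 := (Metric.mem_ball.1 hq).trans_le (min_le_right _ _)
      have htC := hle t ht hq1
      rw [lt_div_iff₀ hC] at hq2
      have htδ : t ∈ Ioo 0 δ := ⟨hγ.subset ht, by linarith⟩
      have h3 : ‖γ t - p₀ - t • v‖ ≤ c / ((‖P‖ + 1) * C) * t := hδs htδ
      have h4 : P (γ t - p₀) = P (γ t - p₀ - t • v) := by
        rw [map_sub P (γ t - p₀), map_smul, hPv, smul_zero, sub_zero]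
      simp only [sub_self, map_zero, sub_zero, zero_apply]
      rw [h4, ← dist_eq_norm (γ t)]
      have hnn : 0 ≤ ‖P‖ := norm_nonneg _
      have hct : 0 ≤ c * t := mul_nonneg hc.le htδ.1.le
      calc ‖P (γ t - p₀ - t • v)‖ ≤ ‖P‖ * (c / ((‖P‖ + 1) * C) * t) :=
            (P.le_opNorm _).trans (by gcongr)
        _ ≤ (‖P‖ + 1) * (c / ((‖P‖ + 1) * C) * t) := by
            refine mul_le_mul_of_nonneg_right (by linarith) ?_
            exact mul_nonneg (by positivity) htδ.1.le
        _ = c / C * t := by field_simp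
        _ ≤ c / C * (C * dist (γ t) p₀) := by gcongr
        _ = c * dist (γ t) p₀ := by field_simp
    have h3 : P y = 0 := h1.unique_on h2 hy
    rw [hP, sub_eq_zero] at h3
    exact Submodule.mem_span_singleton.2 ⟨_, h3.symm⟩
  · intro y hy
    obtain ⟨a, rfl⟩ := Submodule.mem_span_singleton.1 hy
    refine mem_tangentConeAt_of_seq (𝓝[>] (0 : ℝ)) (fun t => a * t⁻¹) (fun t => γ t - p₀) ?_ ?_ ?_
    · rw [← sub_self p₀]
      exact hγ.tendsto.sub_const p₀
    · filter_upwards [hγ.mem_nhdsGT] with t ht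
      rw [add_sub_cancel]
      exact mem_image_of_mem γ ht
    · simp only [mul_smul]
      exact (hγ.tendsto_slope h hV).const_smul a

end Heis

/-! ### Joining the two characteristic curves at `p₀` -/

namespace Heis

variable {u : Plane → ℝ} {Bp Bm : Set Plane} {p₀ v : Plane} {γp γm : ℝ → Plane} {Jp Jm : Set ℝ}
  {V : Plane → Plane} {ν : Plane →L[ℝ] ℝ}

/-- The curve which arrives at `p₀` along `γm`, reversed, and leaves along `γp`. -/
def joinAt (p₀ : Plane) (γm γp : ℝ → Plane) (t : ℝ) : Plane :=
  if 0 < t then γp t else if t < 0 then γm (-t) else p₀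

theorem joinAt_of_pos {t : ℝ} (ht : 0 < t) : joinAt p₀ γm γp t = γp t := if_pos ht

theorem joinAt_of_neg {t : ℝ} (ht : t < 0) : joinAt p₀ γm γp t = γm (-t) := by
  rw [joinAt, if_neg ht.not_gt, if_pos ht]

@[simp] theorem joinAt_zero : joinAt p₀ γm γp 0 = p₀ := by simp [joinAt]

theorem continuousAt_joinAt_zero (hp : Tendsto γp (𝓝[>] 0) (𝓝 p₀))
    (hm : Tendsto γm (𝓝[>] 0) (𝓝 p₀)) : ContinuousAt (joinAt p₀ γm γp) 0 := by
  rw [continuousAt_iff_continuous_left'_right']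
  constructor
  · have hneg : Tendsto (fun t : ℝ => -t) (𝓝[<] 0) (𝓝[>] 0) := by
      simpa using tendsto_neg_nhdsLT (a := (0 : ℝ))
    rw [ContinuousWithinAt, joinAt_zero]
    exact (hm.comp hneg).congr' (eventually_of_mem self_mem_nhdsWithin fun t ht =>
      (joinAt_of_neg ht).symm)
  · rw [ContinuousWithinAt, joinAt_zero]
    exact hp.congr' (eventually_of_mem self_mem_nhdsWithin fun t ht => (joinAt_of_pos ht).symm)

theorem joinAt_eventuallyEq_of_pos {t : ℝ} (ht : 0 < t) : joinAt p₀ γm γp =ᶠ[𝓝 t] γp :=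
  eventually_of_mem (Ioi_mem_nhds ht) fun _ h => joinAt_of_pos h

theorem joinAt_eventuallyEq_of_neg {t : ℝ} (ht : t < 0) :
    joinAt p₀ γm γp =ᶠ[𝓝 t] fun s => γm (-s) :=
  eventually_of_mem (Iio_mem_nhds ht) fun _ h => joinAt_of_neg h

/-- Trajectories which start at `p₀` on the two sides join to a `C¹` curve through `p₀`. -/
theorem isSimpleC1CurveThrough_union (hp : IsExpandingSide V Bp p₀ v ν)
    (hm : IsExpandingSide V Bm p₀ (-v) (-ν)) (hV : Nperp u = unitField V)
    (hBp : IsOpen Bp) (hBm : IsOpen Bm) (hdisj : Disjoint Bp Bm)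
    (hXp : ContDiffOn ℝ 1 (Nperp u) Bp) (hXm : ContDiffOn ℝ 1 (Nperp u) Bm)
    (hVp : ∀ p ∈ Bp, Nperp u p ≠ 0) (hVm : ∀ p ∈ Bm, Nperp u p ≠ 0)
    (hγp : IsStartParam u Bp p₀ γp Jp) (hγm : IsStartParam u Bm p₀ γm Jm) :
    IsSimpleC1CurveThrough (γm '' Jm ∪ {p₀} ∪ γp '' Jp) p₀ := by
  set σ := joinAt p₀ γm γp with hσ
  -- The velocity of the joined curve. Both curves run away from `p₀`, so the one on the minus side
  -- is reversed; its velocity, with limit `-v` at `p₀`, then has limit `v`.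
  set w := joinAt v (fun t => -Nperp u (γm t)) (fun t => Nperp u (γp t)) with hw
  set J : Set ℝ := {t | (0 < t ∧ t ∈ Jp) ∨ t = 0 ∨ (t < 0 ∧ -t ∈ Jm)} with hJ
  have hv0 : v ≠ 0 := by
    rintro rfl
    have := hp.norm_eq
    simp at this
  have hneg : Tendsto (fun t : ℝ => -t) (𝓝[<] 0) (𝓝[>] 0) := by
    simpa using tendsto_neg_nhdsLT (a := (0 : ℝ))
  have hJ0 : J ∈ 𝓝 (0 : ℝ) := by
    rw [← nhdsLT_sup_nhdsGE, ← Ioi_insert, nhdsWithin_insert]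
    refine mem_sup.2 ⟨?_, mem_sup.2 ⟨mem_pure.2 (Or.inr (Or.inl rfl)), ?_⟩⟩
    · filter_upwards [hneg hγm.mem_nhdsGT, self_mem_nhdsWithin] with t ht ht0
      exact Or.inr (Or.inr ⟨ht0, ht⟩)
    · filter_upwards [hγp.mem_nhdsGT, self_mem_nhdsWithin] with t ht ht0
      exact Or.inl ⟨ht0, ht⟩
  have hJo : IsOpen J := by
    rw [isOpen_iff_mem_nhds]
    rintro t (⟨h0, ht⟩ | rfl | ⟨h0, ht⟩)
    · filter_upwards [hγp.maximal.1.isOpen.mem_nhds ht, Ioi_mem_nhds h0] with s hs hs0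
      exact Or.inl ⟨hs0, hs⟩
    · exact hJ0
    · filter_upwards [continuous_neg.continuousAt (hγm.maximal.1.isOpen.mem_nhds ht),
        Iio_mem_nhds h0] with s hs hs0
      exact Or.inr (Or.inr ⟨hs0, hs⟩)
  have hJc : J.OrdConnected := by
    refine ⟨fun x hx y hy z hz => ?_⟩
    rcases lt_trichotomy z 0 with h0 | rfl | h0
    · rcases hx with ⟨h1, -⟩ | rfl | ⟨h1, hx⟩
      · linarith [hz.1]
      · linarith [hz.1]
      · exact Or.inr (Or.inr ⟨h0, hγm.Ioc_subset hx ⟨by linarith, by linarith [hz.1]⟩⟩)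
    · exact Or.inr (Or.inl rfl)
    · rcases hy with ⟨h1, hy⟩ | rfl | ⟨h1, -⟩
      · exact Or.inl ⟨h0, hγp.Ioc_subset hy ⟨h0, hz.2⟩⟩
      · linarith [hz.2]
      · linarith [hz.2]
  have hγpB : Tendsto γp (𝓝[>] 0) (𝓝[Bp] p₀) := tendsto_nhdsWithin_iff.2
    ⟨hγp.tendsto, mem_of_superset hγp.mem_nhdsGT hγp.maximal.1.mapsTo⟩
  have hγmB : Tendsto γm (𝓝[>] 0) (𝓝[Bm] p₀) := tendsto_nhdsWithin_iff.2
    ⟨hγm.tendsto, mem_of_superset hγm.mem_nhdsGT hγm.maximal.1.mapsTo⟩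
  have hw0 : ContinuousAt w 0 := by
    refine continuousAt_joinAt_zero ?_ ?_
    · rw [hV]; exact hp.tendsto.comp hγpB
    · rw [hV]
      have := (hm.tendsto.comp hγmB).neg
      rwa [neg_neg] at this
  have hderpos : ∀ t, 0 < t → t ∈ Jp → HasDerivAt σ (w t) t := fun t h0 ht => by
    rw [hw, joinAt_of_pos h0]
    exact (hγp.maximal.1.hasDerivAt ht).congr_of_eventuallyEq (joinAt_eventuallyEq_of_pos h0)
  have hderneg : ∀ t, t < 0 → -t ∈ Jm → HasDerivAt σ (w t) t := fun t h0 ht => by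
    rw [hw, joinAt_of_neg h0]
    refine HasDerivAt.congr_of_eventuallyEq ?_ (joinAt_eventuallyEq_of_neg h0)
    have h1 := (hγm.maximal.1.hasDerivAt ht).scomp t (hasDerivAt_neg t)
    rwa [neg_one_smul] at h1
  have hσ0 : ContinuousAt σ 0 := continuousAt_joinAt_zero hγp.tendsto hγm.tendsto
  have hder : ∀ t ∈ J, HasDerivAt σ (w t) t := by
    rintro t (⟨h0, ht⟩ | rfl | ⟨h0, ht⟩)
    · exact hderpos t h0 ht
    · have hpos : ∀ᶠ t in 𝓝[>] (0 : ℝ), HasDerivAt σ (w t) t := by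
        filter_upwards [hγp.mem_nhdsGT, self_mem_nhdsWithin] with t ht h0
        exact hderpos t h0 ht
      have hneg' : ∀ᶠ t in 𝓝[<] (0 : ℝ), HasDerivAt σ (w t) t := by
        filter_upwards [hneg hγm.mem_nhdsGT, self_mem_nhdsWithin] with t ht h0
        exact hderneg t h0 ht
      have h1 : HasDerivWithinAt σ (w 0) (Ici 0) 0 :=
        hasDerivWithinAt_Ici_of_tendsto_deriv (s := {t | HasDerivAt σ (w t) t})
          (fun t ht => ht.differentiableAt.differentiableWithinAt) hσ0.continuousWithinAt hpos
          ((hw0.tendsto.mono_left nhdsWithin_le_nhds).congr' (hpos.mono fun t ht => ht.deriv.symm))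
      have h2 : HasDerivWithinAt σ (w 0) (Iic 0) 0 :=
        hasDerivWithinAt_Iic_of_tendsto_deriv (s := {t | HasDerivAt σ (w t) t})
          (fun t ht => ht.differentiableAt.differentiableWithinAt) hσ0.continuousWithinAt hneg'
          ((hw0.tendsto.mono_left nhdsWithin_le_nhds).congr' (hneg'.mono fun t ht => ht.deriv.symm))
      have h3 := h1.union h2
      rw [Ici_union_Iic, hasDerivWithinAt_univ] at h3
      exact h3
    · exact hderneg t h0 ht
  have hwc : ∀ t ∈ J, ContinuousAt w t := by
    rintro t (⟨h0, ht⟩ | rfl | ⟨h0, ht⟩)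
    · refine ContinuousAt.congr ?_ (joinAt_eventuallyEq_of_pos h0).symm
      exact ContinuousAt.comp (g := Nperp u)
        (hXp.continuousOn.continuousAt (hBp.mem_nhds (hγp.maximal.1.mapsTo ht)))
        (hγp.maximal.1.hasDerivAt ht).continuousAt
    · exact hw0
    · refine ContinuousAt.congr ?_ (joinAt_eventuallyEq_of_neg h0).symm
      have h1 : ContinuousAt (fun s => γm (-s)) t :=
        ContinuousAt.comp (g := γm) (hγm.maximal.1.hasDerivAt ht).continuousAt
          continuous_neg.continuousAt
      exact (ContinuousAt.comp (g := Nperp u) (f := fun s => γm (-s))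
        (hXm.continuousOn.continuousAt (hBm.mem_nhds (hγm.maximal.1.mapsTo ht))) h1).neg
  have hw_ne : ∀ t ∈ J, w t ≠ 0 := by
    rintro t (⟨h0, ht⟩ | rfl | ⟨h0, ht⟩)
    · rw [hw, joinAt_of_pos h0]; exact hVp _ (hγp.maximal.1.mapsTo ht)
    · rw [hw, joinAt_zero]; exact hv0
    · rw [hw, joinAt_of_neg h0]; exact neg_ne_zero.2 (hVm _ (hγm.maximal.1.mapsTo ht))
  have hinj : InjOn σ J := by
    have hip := hγp.injOn hBp hXp hp.notMem
    have him := hγm.injOn hBm hXm hm.notMem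
    have hne : ∀ s ∈ Jp, ∀ t ∈ Jm, γp s ≠ γm t := fun s hs t ht heq =>
      disjoint_left.1 hdisj (hγp.maximal.1.mapsTo hs) (heq ▸ hγm.maximal.1.mapsTo ht)
    have hpne : ∀ s ∈ Jp, γp s ≠ p₀ := fun s hs heq =>
      hp.notMem (heq ▸ hγp.maximal.1.mapsTo hs)
    have hmne : ∀ s ∈ Jm, γm s ≠ p₀ := fun s hs heq =>
      hm.notMem (heq ▸ hγm.maximal.1.mapsTo hs)
    rintro s (⟨hs0, hs⟩ | rfl | ⟨hs0, hs⟩) t (⟨ht0, ht⟩ | rfl | ⟨ht0, ht⟩) heq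
    · rw [hσ, joinAt_of_pos hs0, joinAt_of_pos ht0] at heq
      exact hip hs ht heq
    · rw [hσ, joinAt_of_pos hs0, joinAt_zero] at heq
      exact absurd heq (hpne s hs)
    · rw [hσ, joinAt_of_pos hs0, joinAt_of_neg ht0] at heq
      exact absurd heq (hne s hs _ ht)
    · rw [hσ, joinAt_zero, joinAt_of_pos ht0] at heq
      exact absurd heq.symm (hpne t ht)
    · rfl
    · rw [hσ, joinAt_zero, joinAt_of_neg ht0] at heq
      exact absurd heq.symm (hmne _ ht)
    · rw [hσ, joinAt_of_neg hs0, joinAt_of_pos ht0] at heq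
      exact absurd heq.symm (hne t ht _ hs)
    · rw [hσ, joinAt_of_neg hs0, joinAt_zero] at heq
      exact absurd heq (hmne _ hs)
    · rw [hσ, joinAt_of_neg hs0, joinAt_of_neg ht0] at heq
      exact neg_injective (him hs ht heq)
  have hmemp : ∀ t ∈ Jp, t ∈ J ∧ σ t = γp t := fun t ht =>
    ⟨Or.inl ⟨hγp.subset ht, ht⟩, joinAt_of_pos (hγp.subset ht)⟩
  have hmemm : ∀ t ∈ Jm, -t ∈ J ∧ σ (-t) = γm t := fun t ht => by
    have h0 : -t < 0 := neg_lt_zero.2 (hγm.subset ht)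
    refine ⟨Or.inr (Or.inr ⟨h0, by rwa [neg_neg]⟩), ?_⟩
    rw [hσ, joinAt_of_neg h0, neg_neg]
  have h0J : (0 : ℝ) ∈ J := Or.inr (Or.inl rfl)
  have himage : γm '' Jm ∪ {p₀} ∪ γp '' Jp = σ '' J := by
    apply Subset.antisymm
    · rintro _ ((⟨t, ht, rfl⟩ | rfl) | ⟨t, ht, rfl⟩)
      · exact ⟨-t, hmemm t ht⟩
      · exact ⟨0, h0J, joinAt_zero⟩
      · exact ⟨t, hmemp t ht⟩
    · rintro _ ⟨t, ⟨h0, ht⟩ | rfl | ⟨h0, ht⟩, rfl⟩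
      · exact Or.inr ⟨t, ht, (joinAt_of_pos h0).symm⟩
      · exact Or.inl (Or.inr joinAt_zero)
      · exact Or.inl (Or.inl ⟨-t, ht, (joinAt_of_neg h0).symm⟩)
  have hsmooth : ContDiffOn ℝ 1 σ J := by
    have h1 : ContDiffOn ℝ (0 + 1) σ J :=
      (contDiffOn_succ_iff_deriv_of_isOpen hJo).2
        ⟨fun t ht => (hder t ht).differentiableAt.differentiableWithinAt, by simp,
          contDiffOn_zero.2 (ContinuousOn.congr (f := w)
            (fun t ht => (hwc t ht).continuousWithinAt) fun t ht => (hder t ht).deriv)⟩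
    simpa using h1
  refine ⟨σ, J, ⟨hJo, hJc, ⟨0, h0J⟩, hsmooth, fun t ht => ?_⟩, hinj, himage, 0, h0J,
    joinAt_zero, fun I hI => ?_⟩
  · rw [(hder t ht).deriv]; exact hw_ne t ht
  · obtain ⟨δ, hδ, hδI⟩ := Metric.mem_nhds_iff.1 hI
    -- Points of either branch near `p₀` have small time parameters, which rules out any other
    -- approach to `p₀`.
    obtain ⟨C, hC, d, hd, hle⟩ := hγp.exists_time_le hp hV
    obtain ⟨C', hC', d', hd', hle'⟩ := hγm.exists_time_le hm hV
    rw [mem_nhdsWithin_iff_exists_mem_nhds_inter]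
    refine ⟨Metric.ball p₀ (min (min d (δ / C)) (min d' (δ / C'))),
      Metric.ball_mem_nhds _ (by positivity), ?_⟩
    rintro q ⟨hq, hqΓ⟩
    have hq1 := (Metric.mem_ball.1 hq).trans_le (min_le_left _ _)
    have hq2 := (Metric.mem_ball.1 hq).trans_le (min_le_right _ _)
    rcases hqΓ with (⟨t, ht, rfl⟩ | rfl) | ⟨t, ht, rfl⟩
    · have h1 := hle' t ht (hq2.trans_le (min_le_left _ _))
      have h2 := hq2.trans_le (min_le_right _ _)
      rw [lt_div_iff₀ hC'] at h2
      refine ⟨-t, ⟨hδI ?_, (hmemm t ht).1⟩, (hmemm t ht).2⟩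
      rw [Metric.mem_ball, dist_zero_right, norm_neg, Real.norm_of_nonneg (hγm.subset ht).le]
      linarith
    · exact ⟨0, ⟨mem_of_mem_nhds hI, h0J⟩, joinAt_zero⟩
    · have h1 := hle t ht (hq1.trans_le (min_le_left _ _))
      have h2 := hq1.trans_le (min_le_right _ _)
      rw [lt_div_iff₀ hC] at h2
      refine ⟨t, ⟨hδI ?_, (hmemp t ht).1⟩, (hmemp t ht).2⟩
      rw [Metric.mem_ball, dist_zero_right, Real.norm_of_nonneg (hγp.subset ht).le]
      linarith

/-! ### The field `V` and its derivative of rank one and trace two -/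

theorem plane_eq_smul_add (x : Plane) :
    x = x 0 • EuclideanSpace.single 0 (1 : ℝ) + x 1 • EuclideanSpace.single 1 (1 : ℝ) := by
  ext i
  fin_cases i <;> simp

/-- A linear map of the plane with nontrivial kernel and trace `2` has rank one. -/
theorem exists_eq_smulRight (A : Plane →L[ℝ] Plane) {T : Plane} (hT : T ≠ 0) (hAT : A T = 0)
    (htr : A (EuclideanSpace.single 0 1) 0 + A (EuclideanSpace.single 1 1) 1 = 2) :
    ∃ (v : Plane) (ν : Plane →L[ℝ] ℝ), A = ν.smulRight v ∧ ‖v‖ = 1 ∧ ν v = 2 ∧ ν T = 0 := by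
  set e₀ : Plane := EuclideanSpace.single 0 1
  set e₁ : Plane := EuclideanSpace.single 1 1
  have hA : ∀ x : Plane, A x = x 0 • A e₀ + x 1 • A e₁ := fun x => by
    conv_lhs => rw [plane_eq_smul_add x]
    rw [map_add, map_smul, map_smul]
  have hA0 : T 0 * A e₀ 0 + T 1 * A e₁ 0 = 0 := by
    have := congrArg (fun z : Plane => z 0) ((hA T).symm.trans hAT)
    simpa using this
  have hA1 : T 0 * A e₀ 1 + T 1 * A e₁ 1 = 0 := by
    have := congrArg (fun z : Plane => z 1) ((hA T).symm.trans hAT)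
    simpa using this
  set m : ℝ := T 0 ^ 2 + T 1 ^ 2 with hm
  have hm0 : m ≠ 0 := by
    intro h0
    apply hT
    have h1 : T 0 = 0 := by nlinarith [sq_nonneg (T 0), sq_nonneg (T 1)]
    have h2 : T 1 = 0 := by nlinarith [sq_nonneg (T 0), sq_nonneg (T 1)]
    ext i
    fin_cases i
    · simpa using h1
    · simpa using h2
  -- `W` is the image under `A` of `T` rotated by a right angle, and `n` is the functional that
  -- kills `T` and is `1` on the rotated vector. So `A = n ⊗ W`, and `n W` is the trace.
  set W : Plane := (-T 1) • A e₀ + T 0 • A e₁ with hW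
  let n : Plane →L[ℝ] ℝ := (T 0 / m) • EuclideanSpace.proj (1 : Fin 2) -
    (T 1 / m) • EuclideanSpace.proj (0 : Fin 2)
  have hn : ∀ x, n x = (T 0 * x 1 - T 1 * x 0) / m := fun x => by
    simp [n]; ring
  have hAn : ∀ x, A x = n x • W := by
    intro x
    rw [hA x, hn, hW]
    ext i
    fin_cases i
    · simp
      field_simp
      linear_combination (x 0 * A e₀ 0 + x 1 * A e₁ 0) * hm + (x 0 * T 0 + x 1 * T 1) * hA0
    · simp
      field_simp
      linear_combination (x 0 * A e₀ 1 + x 1 * A e₁ 1) * hm + (x 0 * T 0 + x 1 * T 1) * hA1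
  have hnW : n W = 2 := by
    rw [hn, hW, div_eq_iff hm0]
    simp
    linear_combination (-T 1) * hA1 * 1 + (-T 0) * hA0 + m * htr
  have hnT : n T = 0 := by rw [hn]; ring
  have hW0 : ‖W‖ ≠ 0 := by
    intro h0
    rw [norm_eq_zero.1 h0, map_zero] at hnW
    norm_num at hnW
  refine ⟨‖W‖⁻¹ • W, ‖W‖ • n, ?_, ?_, ?_, ?_⟩
  · ext1 x
    rw [hAn]
    simp [smul_smul]
    field_simp
  · rw [norm_smul, norm_inv, norm_norm, inv_mul_cancel₀ hW0]
  · rw [map_smul, smul_apply, hnW, smul_eq_mul, smul_eq_mul,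
      inv_mul_cancel_left₀ hW0]
  · simp [hnT]

/-- The field `D N^⊥(u) = (u_y + x, -(u_x - y))`. -/
def charField (u : Plane → ℝ) (p : Plane) : Plane := !₂[dy u p + p 0, -(dx u p - p 1)]

end Heis

namespace Heis

variable {u : Plane → ℝ} {Ω : Set Plane} {p : Plane}

theorem norm_charField (u : Plane → ℝ) (p : Plane) : ‖charField u p‖ = D u p := by
  rw [EuclideanSpace.norm_eq, Fin.sum_univ_two, D]
  simp [charField]
  congr 1
  ring

theorem nperp_eq_unitField (u : Plane → ℝ) : Nperp u = unitField (charField u) := by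
  ext p i
  rw [unitField, norm_charField]
  fin_cases i
  · simp [Nperp, N, charField]; ring
  · simp [Nperp, N, charField]; ring

theorem charField_eq_zero_iff :
    charField u p = 0 ↔ dx u p - p 1 = 0 ∧ dy u p + p 0 = 0 := by
  constructor
  · intro h
    have h0 := congrArg (fun z : Plane => z 0) h
    have h1 := congrArg (fun z : Plane => z 1) h
    simp only [charField] at h0 h1
    exact ⟨neg_eq_zero.1 (by simpa using h1), by simpa using h0⟩
  · rintro ⟨h0, h1⟩
    simp only [charField, h0, h1]
    ext i
    fin_cases i <;> simp

theorem contDiffOn_dx (hΩ : IsOpen Ω) (hu : ContDiffOn ℝ 2 u Ω) : ContDiffOn ℝ 1 (dx u) Ω :=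
  (hu.fderiv_of_isOpen hΩ (m := 1) (by norm_num)).clm_apply contDiffOn_const

theorem contDiffOn_dy (hΩ : IsOpen Ω) (hu : ContDiffOn ℝ 2 u Ω) : ContDiffOn ℝ 1 (dy u) Ω :=
  (hu.fderiv_of_isOpen hΩ (m := 1) (by norm_num)).clm_apply contDiffOn_const

theorem contDiff_coord (i : Fin 2) : ContDiff ℝ 1 fun p : Plane => p i :=
  (EuclideanSpace.proj (𝕜 := ℝ) i).contDiff

theorem contDiffOn_charField (hΩ : IsOpen Ω) (hu : ContDiffOn ℝ 2 u Ω) :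
    ContDiffOn ℝ 1 (charField u) Ω := by
  rw [contDiffOn_euclidean]
  intro i
  fin_cases i
  · exact (contDiffOn_dy hΩ hu).add (contDiff_coord 0).contDiffOn
  · exact ((contDiffOn_dx hΩ hu).sub (contDiff_coord 1).contDiffOn).neg

theorem contDiffOn_nperp (hΩ : IsOpen Ω) (hu : ContDiffOn ℝ 2 u Ω) {B : Set Plane} (hB : B ⊆ Ω)
    (h0 : ∀ p ∈ B, charField u p ≠ 0) : ContDiffOn ℝ 1 (Nperp u) B := by
  have h1 := (contDiffOn_charField hΩ hu).mono hB
  rw [nperp_eq_unitField]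
  exact ((h1.norm ℝ h0).inv fun p hp => norm_ne_zero_iff.2 (h0 p hp)).smul h1

/-- The divergence of `(u_y + x, -u_x + y)` is `u_xy + 1 - u_xy + 1`. This is where `u ∈ C²` enters
through the symmetry of second derivatives. -/
theorem trace_fderiv_charField (hΩ : IsOpen Ω) (hu : ContDiffOn ℝ 2 u Ω) (hp : p ∈ Ω) :
    fderiv ℝ (charField u) p (EuclideanSpace.single 0 1) 0 +
      fderiv ℝ (charField u) p (EuclideanSpace.single 1 1) 1 = 2 := by
  have hn := hΩ.mem_nhds hp
  have hd : HasFDerivAt (charField u) (fderiv ℝ (charField u) p) p :=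
    (((contDiffOn_charField hΩ hu).contDiffAt hn).differentiableAt (by norm_num)).hasFDerivAt
  have hfd : HasFDerivAt (fderiv ℝ u) (fderiv ℝ (fderiv ℝ u) p) p :=
    (((hu.fderiv_of_isOpen hΩ (m := 1) (by norm_num)).contDiffAt hn).differentiableAt
      (by norm_num)).hasFDerivAt
  have hcoord : ∀ (i : Fin 2) (p : Plane), HasFDerivAt (fun p : Plane => p i)
      (EuclideanSpace.proj (𝕜 := ℝ) i : Plane →L[ℝ] ℝ) p :=
    fun i _ => (EuclideanSpace.proj (𝕜 := ℝ) i).hasFDerivAt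
  have hpart : ∀ e : Plane, HasFDerivAt (fun p => fderiv ℝ u p e)
      ((fderiv ℝ (fderiv ℝ u) p).flip e) p := fun e => by
    simpa using hfd.clm_apply (hasFDerivAt_const e p)
  have h0 := HasFDerivAt.unique (f := fun q => dy u q + q 0)
    (HasFDerivAt.comp (g := fun z : Plane => z 0) p (hcoord 0 _) hd)
    ((hpart (EuclideanSpace.single 1 1)).add (hcoord 0 p))
  have h1 := HasFDerivAt.unique (f := fun q => -(dx u q - q 1))
    (HasFDerivAt.comp (g := fun z : Plane => z 1) p (hcoord 1 _) hd)
    ((hpart (EuclideanSpace.single 0 1)).sub (hcoord 1 p)).neg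
  have h0' := congrArg (fun f => f (EuclideanSpace.single 0 1)) h0
  have h1' := congrArg (fun f => f (EuclideanSpace.single 1 1)) h1
  have hsymm := (hu.contDiffAt hn).isSymmSndFDerivAt (by simp)
    (EuclideanSpace.single 0 1) (EuclideanSpace.single 1 1)
  simp at h0' h1'
  rw [h0', h1', hsymm]
  ring

/-! ### The two sides of the singular curve -/

/-- Near a point of a regular curve of zeros of `V`, the points off the curve lie in two connected
sets, on which `V` points in nearly opposite directions. -/
theorem exists_two_sides {V : Plane → Plane} {p₀ v T : Plane} {ν : Plane →L[ℝ] ℝ}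
    (hV : HasStrictFDerivAt V (ν.smulRight v) p₀) (hv : ‖v‖ = 1) (hνv : ν v = 2)
    (hT : T ≠ 0) (hνT : ν T = 0) {c : ℝ → Plane} {J : Set ℝ} (hJ : IsOpen J)
    (hcJ : ContinuousOn c J) {s₀ : ℝ} (hs₀ : s₀ ∈ J) (hc : HasStrictDerivAt c T s₀)
    (hc0 : c s₀ = p₀) (hVc : ∀ s ∈ J, V (c s) = 0) {ε κ : ℝ} (hε : 0 < ε) (hκ : 0 < κ) :
    ∃ Qp Qm : Set Plane, IsPreconnected Qp ∧ IsPreconnected Qm ∧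
      (∀ᶠ p in 𝓝 p₀, p ∈ Qp ∨ p ∈ Qm ∨ p ∈ c '' J) ∧
      (∀ p ∈ Qp, p ∈ Metric.ball p₀ ε ∧ 0 < ν (V p) ∧ ‖unitField V p - v‖ ≤ κ) ∧
      (∀ p ∈ Qm, p ∈ Metric.ball p₀ ε ∧ ν (V p) < 0 ∧ ‖unitField V p + v‖ ≤ κ) := by
  set L := ‖ν‖ with hL
  have hL0 : 0 ≤ L := norm_nonneg _
  have hκ' : 0 < min κ (1 / (L + 1)) := by positivity
  obtain ⟨r, hr, hVr⟩ := IsExpandingSide.exists_norm_sub_le hV hκ'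
  set κ' := min κ (1 / (L + 1))
  have hLκ : L * κ' ≤ 1 := by
    calc L * κ' ≤ L * (1 / (L + 1)) := by gcongr; exact min_le_right _ _
      _ ≤ 1 := by rw [mul_one_div, div_le_one (by positivity)]; linarith
  -- Coordinates along the curve and in direction `v`; they cover a neighbourhood of `p₀` because
  -- `ν` separates `v` from `T`.
  let Φ : ℝ × ℝ → Plane := fun z => c z.1 + z.2 • v
  have hΦ0 : Φ (s₀, 0) = p₀ := by simp [Φ, hc0]
  let Φ' : ℝ × ℝ →L[ℝ] Plane := (ContinuousLinearMap.fst ℝ ℝ ℝ).smulRight T +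
    (ContinuousLinearMap.snd ℝ ℝ ℝ).smulRight v
  have hΦ' : HasStrictFDerivAt Φ Φ' (s₀, 0) := by
    have h1 : HasStrictFDerivAt (fun z : ℝ × ℝ => c z.1)
        ((ContinuousLinearMap.fst ℝ ℝ ℝ).smulRight T) (s₀, 0) := by
      have := HasStrictFDerivAt.comp (g := c) (f := Prod.fst) ((s₀, 0) : ℝ × ℝ)
        hc.hasStrictFDerivAt hasStrictFDerivAt_fst
      convert! this using 1
    have h2 : HasStrictFDerivAt (fun z : ℝ × ℝ => z.2 • v)
        ((ContinuousLinearMap.snd ℝ ℝ ℝ).smulRight v) (s₀, 0) :=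
      ((ContinuousLinearMap.snd ℝ ℝ ℝ).smulRight v).hasStrictFDerivAt
    exact h1.add h2
  have hsurj : Φ'.range = ⊤ := by
    refine LinearMap.range_eq_top.2 ?_
    refine (LinearMap.injective_iff_surjective_of_finrank_eq_finrank (by simp)).1 ?_
    refine (injective_iff_map_eq_zero _).2 fun z hz => ?_
    have hz' : z.1 • T + z.2 • v = 0 := hz
    have h2 : z.2 = 0 := by
      have := congrArg ν hz'
      simpa [hνT, hνv] using this
    have h1 : z.1 = 0 := by
      rw [h2, zero_smul, add_zero] at hz'
      exact (smul_eq_zero.1 hz').resolve_right hT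
    exact Prod.ext h1 h2
  have hmap := hΦ'.map_nhds_eq_of_surj hsurj
  rw [hΦ0] at hmap
  have hnhds : ∀ᶠ z in 𝓝 ((s₀, 0) : ℝ × ℝ), z.1 ∈ J ∧ Φ z ∈ Metric.ball p₀ (min r ε) := by
    have h1 : ∀ᶠ z in 𝓝 ((s₀, 0) : ℝ × ℝ), z.1 ∈ J :=
      continuous_fst.continuousAt (hJ.mem_nhds hs₀)
    have h2 : ∀ᶠ z in 𝓝 ((s₀, 0) : ℝ × ℝ), Φ z ∈ Metric.ball p₀ (min r ε) := by
      refine hΦ'.continuousAt ?_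
      rw [hΦ0]
      exact Metric.ball_mem_nhds _ (lt_min hr hε)
    exact h1.and h2
  obtain ⟨δ, hδ, hδs⟩ := Metric.eventually_nhds_iff.1 hnhds
  have hbox : ∀ s τ, |s - s₀| < δ → |τ| < δ → s ∈ J ∧ Φ (s, τ) ∈ Metric.ball p₀ (min r ε) := by
    intro s τ hs hτ
    refine hδs (y := (s, τ)) ?_
    rw [Prod.dist_eq, max_lt_iff, Real.dist_eq, Real.dist_eq]
    exact ⟨hs, by simpa using hτ⟩
  -- Comparing with the foot `c s`, where `V` vanishes, gives an error relative to `|τ|` and not to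
  -- the distance from `p₀`. This makes the direction of `V` uniform up to the curve.
  have hVΦ : ∀ s τ, |s - s₀| < δ → |τ| < δ → ‖V (Φ (s, τ)) - (τ * 2) • v‖ ≤ κ' * |τ| := by
    intro s τ hs hτ
    have h1 := hbox s τ hs hτ
    have h2 := (hbox s 0 hs (by simpa using hδ)).2
    have hΦs : Φ (s, 0) = c s := by simp [Φ]
    have h3 := hVr _ (Metric.ball_subset_ball (min_le_left _ _) h1.2) _
      (Metric.ball_subset_ball (min_le_left _ _) h2)
    have h4 : Φ (s, τ) - Φ (s, 0) = τ • v := by simp [Φ]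
    rw [h4, map_smul, hνv, smul_eq_mul, norm_smul, hv, mul_one, hΦs, hVc s h1.1, sub_zero,
      Real.norm_eq_abs] at h3
    exact h3
  have hνV : ∀ s τ, |s - s₀| < δ → |τ| < δ → |ν (V (Φ (s, τ))) - 4 * τ| ≤ |τ| := by
    intro s τ hs hτ
    have h1 := ν.le_opNorm (V (Φ (s, τ)) - (τ * 2) • v)
    have h2 := hVΦ s τ hs hτ
    rw [map_sub, map_smul, hνv, smul_eq_mul, Real.norm_eq_abs] at h1
    calc |ν (V (Φ (s, τ))) - 4 * τ| = |ν (V (Φ (s, τ))) - τ * 2 * 2| := by congr 1; ring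
      _ ≤ L * (κ' * |τ|) := h1.trans (by gcongr)
      _ = L * κ' * |τ| := by ring
      _ ≤ |τ| := mul_le_of_le_one_left (abs_nonneg _) hLκ
  have hXΦ : ∀ s τ, |s - s₀| < δ → |τ| < δ → τ ≠ 0 →
      ‖unitField V (Φ (s, τ)) - (|τ|⁻¹ * τ) • v‖ ≤ κ := by
    intro s τ hs hτ hτ0
    have h1 := hVΦ s τ hs hτ
    have hτ' : 0 < |τ| := abs_pos.2 hτ0
    have hn : ‖(τ * 2) • v‖ = 2 * |τ| := by
      rw [norm_smul, hv, mul_one, Real.norm_eq_abs, abs_mul, abs_two, mul_comm]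
    have h2 := norm_normalize_sub_le ((τ * 2) • v) (V (Φ (s, τ)))
      (norm_pos_iff.1 (by rw [hn]; positivity))
    rw [hn, smul_smul] at h2
    have h3 : (2 * |τ|)⁻¹ * (τ * 2) = |τ|⁻¹ * τ := by field_simp
    rw [h3] at h2
    refine h2.trans ?_
    calc 2 * ‖V (Φ (s, τ)) - (τ * 2) • v‖ / (2 * |τ|) ≤ 2 * (κ' * |τ|) / (2 * |τ|) := by gcongr
      _ = κ' := by field_simp
      _ ≤ κ := min_le_left _ _
  have hconn : ∀ I : Set ℝ, Convex ℝ I → IsPreconnected (Φ '' (Metric.ball s₀ δ ×ˢ I)) := by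
    intro I hI
    refine ((convex_ball s₀ δ).prod hI).isPreconnected.image Φ ?_
    refine ContinuousOn.add ?_ (by fun_prop)
    refine hcJ.comp continuousOn_fst fun z hz => ?_
    have hz1 : |z.1 - s₀| < δ := by rw [← Real.dist_eq]; exact hz.1
    exact (hbox z.1 0 hz1 (by simpa using hδ)).1
  refine ⟨Φ '' (Metric.ball s₀ δ ×ˢ Ioo 0 δ), Φ '' (Metric.ball s₀ δ ×ˢ Ioo (-δ) 0),
    hconn _ (convex_Ioo _ _), hconn _ (convex_Ioo _ _), ?_, ?_, ?_⟩
  · rw [← hmap, eventually_map]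
    refine Metric.eventually_nhds_iff.2 ⟨δ, hδ, fun z hz => ?_⟩
    rw [Prod.dist_eq, max_lt_iff] at hz
    have hz2 : |z.2| < δ := by simpa using hz.2
    rcases lt_trichotomy z.2 0 with h0 | h0 | h0
    · exact Or.inr (Or.inl ⟨z, ⟨hz.1, (abs_lt.1 hz2).1, h0⟩, rfl⟩)
    · refine Or.inr (Or.inr ⟨z.1, (hbox z.1 z.2 hz.1 hz2).1, ?_⟩)
      simp [Φ, h0]
    · exact Or.inl ⟨z, ⟨hz.1, h0, (abs_lt.1 hz2).2⟩, rfl⟩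
  · rintro _ ⟨⟨s, τ⟩, ⟨hs, hτ0, hτδ⟩, rfl⟩
    simp only at hτ0 hτδ hs
    have hs' : |s - s₀| < δ := hs
    have hτ : |τ| < δ := by rwa [abs_of_pos hτ0]
    refine ⟨Metric.ball_subset_ball (min_le_right _ _) (hbox s τ hs' hτ).2, ?_, ?_⟩
    · have := hνV s τ hs' hτ
      rw [abs_of_pos hτ0] at this
      linarith [(abs_le.1 this).1]
    · have := hXΦ s τ hs' hτ hτ0.ne'
      rwa [abs_of_pos hτ0, inv_mul_cancel₀ hτ0.ne', one_smul] at this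
  · rintro _ ⟨⟨s, τ⟩, ⟨hs, hτδ, hτ0⟩, rfl⟩
    simp only at hτ0 hτδ hs
    have hs' : |s - s₀| < δ := hs
    have hτ : |τ| < δ := by rw [abs_of_neg hτ0]; linarith
    refine ⟨Metric.ball_subset_ball (min_le_right _ _) (hbox s τ hs' hτ).2, ?_, ?_⟩
    · have := hνV s τ hs' hτ
      rw [abs_of_neg hτ0] at this
      linarith [(abs_le.1 this).2]
    · have := hXΦ s τ hs' hτ hτ0.ne
      rwa [abs_of_neg hτ0, inv_neg, neg_mul, inv_mul_cancel₀ hτ0.ne, neg_one_smul,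
        sub_neg_eq_add] at this

/-- The two components of a disc cut by a regular curve of zeros of `V` are expanding sides. -/
theorem exists_isExpandingSide {V : Plane → Plane} {p₀ v T : Plane} {ν : Plane →L[ℝ] ℝ}
    (hV : HasStrictFDerivAt V (ν.smulRight v) p₀) (hv : ‖v‖ = 1) (hνv : ν v = 2)
    (hT : T ≠ 0) (hνT : ν T = 0) {c : ℝ → Plane} {J : Set ℝ} (hJ : IsOpen J)
    (hcJ : ContinuousOn c J) {s₀ : ℝ} (hs₀ : s₀ ∈ J) (hc : HasStrictDerivAt c T s₀)
    (hc0 : c s₀ = p₀) (hVc : ∀ s ∈ J, V (c s) = 0) {ε : ℝ} (hε : 0 < ε) {Bp Bm : Set Plane}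
    (hBp : IsOpen Bp) (hBm : IsOpen Bm) (hdisj : Disjoint Bp Bm)
    (hcover : Metric.ball p₀ ε \ (c '' J ∩ Metric.ball p₀ ε) = Bp ∪ Bm)
    (hclp : p₀ ∈ closure Bp) (hclm : p₀ ∈ closure Bm) :
    ∃ (v : Plane) (ν : Plane →L[ℝ] ℝ), IsExpandingSide V Bp p₀ v ν ∧
      IsExpandingSide V Bm p₀ (-v) (-ν) := by
  have hside : ∀ {κ : ℝ}, 0 < κ → _ := fun {κ} hκ =>
    exists_two_sides hV hv hνv hT hνT hJ hcJ hs₀ hc hc0 hVc hε hκ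
  have hV0 : V p₀ = 0 := hc0 ▸ hVc s₀ hs₀
  have hoff : ∀ p ∈ Bp ∪ Bm, p ∉ c '' J := fun p hp hpc => by
    rw [← hcover] at hp
    exact hp.2 ⟨hpc, hp.1⟩
  have hzero : ∀ p ∈ c '' J, V p = 0 := by rintro _ ⟨s, hs, rfl⟩; exact hVc s hs
  have hin : ∀ p ∈ Metric.ball p₀ ε, V p ≠ 0 → p ∈ Bp ∪ Bm := fun p hp hp0 => by
    rw [← hcover]
    exact ⟨hp, fun h => hp0 (hzero p h.1)⟩
  have hlimp : ∀ κ > 0, ∀ᶠ p in 𝓝 p₀, 0 < ν (V p) → ‖unitField V p - v‖ ≤ κ := by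
    intro κ hκ
    obtain ⟨Qp, Qm, -, -, hev, hQp, hQm⟩ := hside hκ
    filter_upwards [hev] with p hp hpos
    rcases hp with hp | hp | hp
    · exact (hQp p hp).2.2
    · exact absurd (hQm p hp).2.1 hpos.not_gt
    · rw [hzero p hp, map_zero] at hpos; exact absurd hpos (lt_irrefl _)
  have hlimm : ∀ κ > 0, ∀ᶠ p in 𝓝 p₀, ν (V p) < 0 → ‖unitField V p - -v‖ ≤ κ := by
    intro κ hκ
    obtain ⟨Qp, Qm, -, -, hev, hQp, hQm⟩ := hside hκ
    filter_upwards [hev] with p hp hpos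
    rcases hp with hp | hp | hp
    · exact absurd (hQp p hp).2.1 hpos.not_gt
    · rw [sub_neg_eq_add]; exact (hQm p hp).2.2
    · rw [hzero p hp, map_zero] at hpos; exact absurd hpos (lt_irrefl _)
  have hlim : ∀ {B : Set Plane} {w : Plane} {P : Plane → Prop},
      (∀ κ > 0, ∀ᶠ p in 𝓝 p₀, P p → ‖unitField V p - w‖ ≤ κ) → (∀ᶠ p in 𝓝 p₀, p ∈ B → P p) →
      Tendsto (unitField V) (𝓝[B] p₀) (𝓝 w) := by
    intro B w P h1 h2
    rw [Metric.tendsto_nhds]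
    intro κ hκ
    rw [eventually_nhdsWithin_iff]
    filter_upwards [h1 (κ / 2) (half_pos hκ), h2] with p hp1 hp2 hpB
    rw [dist_eq_norm]
    linarith [hp1 (hp2 hpB)]
  have hplus : ∀ {B : Set Plane}, (∀ᶠ p in 𝓝 p₀, (p ∈ B ↔ 0 < ν (V p))) →
      IsExpandingSide V B p₀ v ν := fun {B} hB =>
    ⟨hV, hV0, hv, hνv, hB, hlim hlimp (hB.mono fun p hp => hp.1)⟩
  have hminus : ∀ {B : Set Plane}, (∀ᶠ p in 𝓝 p₀, (p ∈ B ↔ ν (V p) < 0)) →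
      IsExpandingSide V B p₀ (-v) (-ν) := fun {B} hB => by
    refine ⟨?_, hV0, by rwa [norm_neg], by simpa using hνv, ?_,
      hlim hlimm (hB.mono fun p hp => hp.1)⟩
    · convert! hV using 1
      ext x
      simp
    · filter_upwards [hB] with p hp
      rw [hp]
      simp
  have key : ∀ {Bp Bm : Set Plane}, IsOpen Bp → IsOpen Bm → Disjoint Bp Bm →
      p₀ ∈ closure Bm → (∀ p ∈ Bp ∪ Bm, p ∉ c '' J) → ∀ {Qp Qm : Set Plane}, IsPreconnected Qm →
      (∀ᶠ p in 𝓝 p₀, p ∈ Qp ∨ p ∈ Qm ∨ p ∈ c '' J) →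
      (∀ p ∈ Qp, 0 < ν (V p)) → (∀ p ∈ Qm, ν (V p) < 0) → Qp ⊆ Bp → Qm ⊆ Bp ∪ Bm →
      (∀ᶠ p in 𝓝 p₀, (p ∈ Bp ↔ 0 < ν (V p))) ∧ ∀ᶠ p in 𝓝 p₀, (p ∈ Bm ↔ ν (V p) < 0) := by
    intro Bp Bm hBp hBm hdisj hclm hoff Qp Qm hQmc hev hQp hQm hpp hm
    have hmm : Qm ⊆ Bm := by
      -- If both pieces lay in `Bp`, no point near `p₀` would be left for `Bm`, contrary to `p₀ ∈
      -- closure Bm`.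
      refine (hQmc.subset_or_subset hBp hBm hdisj hm).resolve_left fun hmp => ?_
      obtain ⟨p, hpm, hp⟩ := (mem_closure_iff_frequently.1 hclm).and_eventually hev |>.exists
      rcases hp with hp | hp | hp
      · exact disjoint_left.1 hdisj (hpp hp) hpm
      · exact disjoint_left.1 hdisj (hmp hp) hpm
      · exact hoff p (Or.inr hpm) hp
    constructor
    · filter_upwards [hev] with p hp
      rcases hp with hp | hp | hp
      · exact ⟨fun _ => hQp p hp, fun _ => hpp hp⟩
      · exact ⟨fun h => absurd (hmm hp) (disjoint_left.1 hdisj h),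
          fun h => absurd (hQm p hp) h.not_gt⟩
      · exact ⟨fun h => absurd hp (hoff p (Or.inl h)), fun h => by
          rw [hzero p hp, map_zero] at h; exact absurd h (lt_irrefl _)⟩
    · filter_upwards [hev] with p hp
      rcases hp with hp | hp | hp
      · exact ⟨fun h => absurd h (disjoint_left.1 hdisj (hpp hp)),
          fun h => absurd (hQp p hp) h.not_gt⟩
      · exact ⟨fun _ => hQm p hp, fun _ => hmm hp⟩
      · exact ⟨fun h => absurd hp (hoff p (Or.inr h)), fun h => by
          rw [hzero p hp, map_zero] at h; exact absurd h (lt_irrefl _)⟩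
  obtain ⟨Qp, Qm, hQpc, hQmc, hev, hQp, hQm⟩ := hside one_pos
  have hQpsub : Qp ⊆ Bp ∪ Bm := fun p hp => hin p (hQp p hp).1 fun h0 => by
    have := (hQp p hp).2.1
    rw [h0, map_zero] at this; exact lt_irrefl _ this
  have hQmsub : Qm ⊆ Bp ∪ Bm := fun p hp => hin p (hQm p hp).1 fun h0 => by
    have := (hQm p hp).2.1
    rw [h0, map_zero] at this; exact lt_irrefl _ this
  rcases hQpc.subset_or_subset hBp hBm hdisj hQpsub with hsub | hsub
  · obtain ⟨h1, h2⟩ := key hBp hBm hdisj hclm hoff hQmc hev (fun p hp => (hQp p hp).2.1)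
      (fun p hp => (hQm p hp).2.1) hsub hQmsub
    exact ⟨v, ν, hplus h1, hminus h2⟩
  -- Which of the two domains carries the sign `+` is a matter of naming: here `v` and `ν` both
  -- change sign.
  · rw [union_comm] at hQmsub hoff
    obtain ⟨h1, h2⟩ := key hBm hBp hdisj.symm hclp hoff hQmc hev (fun p hp => (hQp p hp).2.1)
      (fun p hp => (hQm p hp).2.1) hsub hQmsub
    refine ⟨-v, -ν, hminus h2, ?_⟩
    rw [neg_neg, neg_neg]
    exact hplus h1

/-- Transversality needs only that the tangents of the singular curve lie in `ker ν`. They do, since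
`V` also has derivative `0` within its zeros. -/
theorem apply_eq_zero_of_mem_tangentConeAt {V : Plane → Plane} {p₀ v : Plane}
    {ν : Plane →L[ℝ] ℝ} (hV : HasFDerivAt V (ν.smulRight v) p₀) (hv : v ≠ 0) (hV0 : V p₀ = 0)
    {Γ : Set Plane} (hΓ : ∀ p ∈ Γ, V p = 0) {y : Plane} (hy : y ∈ tangentConeAt ℝ Γ p₀) :
    ν y = 0 := by
  have h1 : HasFDerivWithinAt V (0 : Plane →L[ℝ] Plane) Γ p₀ :=
    (hasFDerivWithinAt_const (0 : Plane) p₀ Γ).congr hΓ hV0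
  have h2 : ν y • v = 0 := hV.hasFDerivWithinAt.unique_on h1 hy
  exact (smul_eq_zero.1 h2).resolve_right hv

/-- The characteristic curve on one side: existence, uniqueness and transversality. -/
theorem IsStartParam.touchesTransversally {u : Plane → ℝ} {V : Plane → Plane} {B : Set Plane}
    {p₀ v : Plane} {ν : Plane →L[ℝ] ℝ} {γ : ℝ → Plane} {J : Set ℝ}
    (h : IsExpandingSide V B p₀ v ν) (hV : Nperp u = unitField V) (hγ : IsStartParam u B p₀ γ J)
    {Γs : Set Plane} (hp₀ : p₀ ∈ Γs) (hΓs : ∀ p ∈ Γs, V p = 0) :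
    TouchesTransversally (γ '' J) Γs p₀ := by
  refine ⟨hγ.mem_closure, Subset.antisymm ?_ ?_⟩
  · rintro _ ⟨⟨y, hy, rfl⟩, y', hy', heq⟩
    obtain rfl : y' = y := add_left_cancel heq
    rw [hγ.tangentConeAt_eq h hV] at hy'
    obtain ⟨a, rfl⟩ := Submodule.mem_span_singleton.1 hy'
    have hv0 : v ≠ 0 := norm_ne_zero_iff.1 (by rw [h.norm_eq]; norm_num)
    have h1 := apply_eq_zero_of_mem_tangentConeAt h.strict.hasFDerivAt hv0 h.zero hΓs hy
    rw [map_smul, h.apply_eq, smul_eq_mul] at h1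
    have ha : a = 0 := by linarith
    simp [ha]
  · rintro _ rfl
    refine ⟨⟨0, zero_mem_tangentConeAt (subset_closure hp₀), add_zero _⟩,
      0, zero_mem_tangentConeAt (subset_closure hγ.mem_closure), add_zero _⟩

end Heis

end

/-! ### Assembly -/

theorem corollary3p6
    -- a `C²` function on an open set of the plane
    (Ω : Set Plane) (hΩ : IsOpen Ω) (u : Plane → ℝ) (hu : ContDiffOn ℝ 2 u Ω)
    -- a singular curve and a point on it
    (Γs : Set Plane) (hΓs : Heis.IsC1Curve Γs) (hsing : Γs ⊆ Heis.singularSet u Ω)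
    (p₀ : Plane) (hp₀ : p₀ ∈ Γs)
    -- a ball that the singular curve divides into two disjoint nonsingular domains
    (ε : ℝ) (hε : 0 < ε) (hball : Metric.ball p₀ ε ⊆ Ω)
    (Bp Bm : Set Plane) (hBp : IsOpen Bp) (hBm : IsOpen Bm)
    (hBpc : IsConnected Bp) (hBmc : IsConnected Bm) (hdisj : Disjoint Bp Bm)
    (hcover : Metric.ball p₀ ε \ (Γs ∩ Metric.ball p₀ ε) = Bp ∪ Bm)
    (hns : Disjoint (Bp ∪ Bm) (Heis.singularSet u Ω))
    (hclp : p₀ ∈ closure Bp) (hclm : p₀ ∈ closure Bm) :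
    -- the one-sided limits of `N^⊥(u)` at `p₀`
    ∃ vp vm : Plane,
      Tendsto (Heis.Nperp u) (𝓝[Bp] p₀) (𝓝 vp) ∧ Tendsto (Heis.Nperp u) (𝓝[Bm] p₀) (𝓝 vm) ∧
      ∃ Γp Γm : Set Plane,
        -- the unique characteristic curve on the `+` side
        (Heis.IsCharacteristicCurve u Bp Γp ∧ Heis.TouchesTransversally Γp Γs p₀ ∧
          tangentConeAt ℝ (closure Γp) p₀ = (Submodule.span ℝ {vp} : Set Plane) ∧
          ∀ Γ : Set Plane, Heis.IsCharacteristicCurve u Bp Γ → Heis.Touches Γ p₀ → Γ = Γp) ∧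
        -- the unique characteristic curve on the `-` side
        (Heis.IsCharacteristicCurve u Bm Γm ∧ Heis.TouchesTransversally Γm Γs p₀ ∧
          tangentConeAt ℝ (closure Γm) p₀ = (Submodule.span ℝ {vm} : Set Plane) ∧
          ∀ Γ : Set Plane, Heis.IsCharacteristicCurve u Bm Γ → Heis.Touches Γ p₀ → Γ = Γm) ∧
        -- the two curves together with `p₀` form a `C¹` curve
        Heis.IsSimpleC1CurveThrough (Γm ∪ {p₀} ∪ Γp) p₀ := by
  obtain ⟨c, J, hc, rfl⟩ := hΓs
  obtain ⟨s₀, hs₀, hcs₀⟩ := hp₀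
  set V := Heis.charField u with hVdef
  have hVX : Heis.Nperp u = unitField V := Heis.nperp_eq_unitField u
  have hΓ0 : ∀ p ∈ c '' J, V p = 0 := fun p hp => Heis.charField_eq_zero_iff.2 (hsing hp).2
  have hp₀' : p₀ ∈ c '' J := ⟨s₀, hs₀, hcs₀⟩
  have hp₀Ω : p₀ ∈ Ω := hball (Metric.mem_ball_self hε)
  have hV : HasStrictFDerivAt V (fderiv ℝ V p₀) p₀ :=
    ((Heis.contDiffOn_charField hΩ hu).contDiffAt (hΩ.mem_nhds hp₀Ω)).hasStrictFDerivAt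
      (by norm_num)
  have hcs : HasStrictDerivAt c (deriv c s₀) s₀ :=
    (hc.contDiffOn.contDiffAt (hc.isOpen.mem_nhds hs₀)).hasStrictDerivAt (by norm_num)
  -- Chain rule for `V ∘ c`, which is `0` near `s₀`.
  have hker : fderiv ℝ V p₀ (deriv c s₀) = 0 := by
    have h1 : HasDerivAt (V ∘ c) (fderiv ℝ V p₀ (deriv c s₀)) s₀ :=
      HasFDerivAt.comp_hasDerivAt s₀ (by rw [hcs₀]; exact hV.hasFDerivAt) hcs.hasDerivAt
    refine h1.unique ((hasDerivAt_const s₀ (0 : Plane)).congr_of_eventuallyEq ?_)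
    exact eventually_of_mem (hc.isOpen.mem_nhds hs₀) fun s hs => hΓ0 _ (mem_image_of_mem c hs)
  obtain ⟨v₀, ν₀, hA, hv₀, hνv₀, hνT⟩ := Heis.exists_eq_smulRight (fderiv ℝ V p₀)
    (hc.deriv_ne_zero s₀ hs₀) hker (Heis.trace_fderiv_charField hΩ hu hp₀Ω)
  rw [hA] at hV
  obtain ⟨v, ν, hp, hm⟩ := Heis.exists_isExpandingSide hV hv₀ hνv₀ (hc.deriv_ne_zero s₀ hs₀) hνT
    hc.isOpen hc.contDiffOn.continuousOn hs₀ hcs hcs₀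
    (fun s hs => hΓ0 _ (mem_image_of_mem c hs)) hε hBp hBm hdisj hcover hclp hclm
  have hsub : Bp ∪ Bm ⊆ Ω := hcover ▸ sdiff_subset.trans hball
  have hne : ∀ p ∈ Bp ∪ Bm, V p ≠ 0 := fun p hpB h0 =>
    disjoint_left.1 hns hpB ⟨hsub hpB, Heis.charField_eq_zero_iff.1 h0⟩
  have hNne : ∀ p ∈ Bp ∪ Bm, Heis.Nperp u p ≠ 0 := fun p hpB => by
    rw [hVX, unitField]
    exact smul_ne_zero (inv_ne_zero (norm_ne_zero_iff.2 (hne p hpB))) (hne p hpB)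
  have hX := Heis.contDiffOn_nperp hΩ hu hsub hne
  have hXp := hX.mono subset_union_left
  have hXm := hX.mono subset_union_right
  obtain ⟨γp, Jp, hγp⟩ := Heis.exists_isStartParam hp hVX hBp hXp
  obtain ⟨γm, Jm, hγm⟩ := Heis.exists_isStartParam hm hVX hBm hXm
  refine ⟨v, -v, hVX ▸ hp.tendsto, hVX ▸ hm.tendsto, γp '' Jp, γm '' Jm, ?_, ?_, ?_⟩
  · exact ⟨⟨γp, Jp, hγp.maximal.1, hγp.maximal.2, rfl⟩,
      hγp.touchesTransversally hp hVX hp₀' hΓ0, hγp.tangentConeAt_eq hp hVX,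
      fun Γ => hγp.eq_of_touches hp hVX hBp hXp⟩
  · exact ⟨⟨γm, Jm, hγm.maximal.1, hγm.maximal.2, rfl⟩,
      hγm.touchesTransversally hm hVX hp₀' hΓ0, hγm.tangentConeAt_eq hm hVX,
      fun Γ => hγm.eq_of_touches hm hVX hBm hXm⟩
  · exact Heis.isSimpleC1CurveThrough_union hp hm hVX hBp hBm hdisj hXp hXm
      (fun p h => hNne p (Or.inl h)) (fun p h => hNne p (Or.inr h)) hγp hγm
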